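/- Let $\alpha\in W^{1,\infty}(\mathbb R,[0,1))$ be fixed, identified with its Lipschitz continuous representative. **Eulerian coordinates.** Choose a smooth partition of unity $\chi^++\chi^-=1$ on $\mathbb R$ with $0\le\chi^\pm\le1$, $\operatorname{supp}\chi^+\subset(-1,\infty)$, $\operatorname{supp}\chi^-\subset(-\infty,1)$, and put $E_2=\{\bar f+a\chi^++b\chi^-:\bar f\in H^1(\mathbb R),\ a,b\in\mathbb R\}$, $E_1^0=\{\bar f+a\chi^+:\bar f\in L^2(\mathbb R),\ a\in\mathbb R\}$ (these spaces do not depend on the choice). The subscripts ac and sing denote the absolutely continuous and singular parts with respect to Lebesgue measure. $\mathcal D^\alpha$ is the set of triplets $(u,\mu,\nu)$ such that $u\in E_2$; $\mu\le\nu$ are finite positive Radon measures on $\mathbb R$; $\mu_{\rm ac}\le\nu_{\rm ac}$; $d\mu_{\rm ac}=u_x^2\,dx$; $\mu((-\infty,\cdot))\in E_1^0$ and $\nu((-\infty,\cdot))\in E_1^0$; $\frac{d\mu}{d\nu}>0$ $\nu$-a.e.; and $\frac{d\mu_{\rm ac}}{d\nu_{\rm ac}}(x)=1$ for $\nu_{\rm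 ac}$-a.e. $x$ with $u_x(x)<0$. Let $\mathcal D_0^\alpha=\{(u,\mu,\nu)\in\mathcal D^\alpha:\mu=\nu\}$. The measures are identified with their left-continuous primitives $F(x)=\mu((-\infty,x))$ and $G(x)=\nu((-\infty,x))$, and $F_{\rm ac}(x)=\mu_{\rm ac}((-\infty,x))$, $F_{\rm sing}(x)=\mu_{\rm sing}((-\infty,x))$. **The map $L$.** $L((u,\mu,\nu))=(y,U,V,H)$ with $$y(\xi)=\sup\{x\in\mathbb R: x+\nu((-\infty,x))<\xi\},\quad U(\xi)=u(y(\xi)),\quad H(\xi)=\xi-y(\xi),\quad V(\xi)=\int_{-\infty}^{\xi}\frac{d\mu}{d\nu}(y(\eta))\,H_\xi(\eta)\,d\eta .$$ **The projection $P_{\Delta x}$.** For $\Delta x>0$ let $x_i=i\Delta x$ $(i\in\mathbb Z)$, and for $f:\mathbb R\to\mathbb R$ let $f_i=f(x_i)$ and $Df_{2j}=\frac{f_{2j+2}-f_{2j}}{2\Delta x}$. Put $q_{2j}=\sqrt{DF_{{\rm ac},2j}-(Du_{2j})^2}$. Given signs $\sigma_j\in\{-1,1\}$, $j\in\mathbb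 Z$ (which may depend on $\Delta x$), and $(u,\mu,\nu)\in\mathcal D_0^\alpha$, let $P_{\Delta x}((u,F,G))=(u_{\Delta x},F_{\Delta x},G_{\Delta x})$ with $$u_{\Delta x}(x)=\begin{cases}u_{2j}+(Du_{2j}-\sigma_jq_{2j})(x-x_{2j}),& x_{2j}<x\le x_{2j+1},\\ u_{2j+2}+(Du_{2j}+\sigma_jq_{2j})(x-x_{2j+2}),& x_{2j+1}<x\le x_{2j+2},\end{cases}$$ and $G_{\Delta x}=F_{\Delta x}=F_{\Delta x,{\rm ac}}+F_{\Delta x,{\rm sing}}$, where $F_{\Delta x,{\rm sing}}(x)=F_{{\rm sing},2j+2}$ for $x_{2j}<x\le x_{2j+2}$ and $$F_{\Delta x,{\rm ac}}(x)=\begin{cases}F_{{\rm ac},2j}+(Du_{2j}-\sigma_jq_{2j})^2(x-x_{2j}),& x_{2j}<x\le x_{2j+1},\\ \tfrac12(F_{{\rm ac},2j+2}+F_{{\rm ac},2j})-2\sigma_jDu_{2j}\,q_{2j}\Delta x+(Du_{2j}+\sigma_jq_{2j})^2(x-x_{2j+1}),& x_{2j+1}<x\le x_{2j+2}.\end{cases}$$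 **The metric.** For $X=(y,U,V,H)$ let $H_\infty=\lim_{\xi\to\infty}H(\xi)$, $\Omega_d(X)=\{\xi:U_\xi(\xi)<0\}$, $\Omega_c(X)=\{\xi:U_\xi(\xi)\ge0\}$, let $g_1(X)=(1-\alpha(y))V_\xi$ on $\Omega_d(X)$ and $g_1(X)=V_\xi$ on $\Omega_c(X)$, and let $g_2(X)=\|\alpha'\|_\infty H_\infty U_\xi$, $g_3(X)=\|\alpha'\|_\infty UU_\xi$ on $\Omega_d(X)$ and $g_2(X)=g_3(X)=0$ on $\Omega_c(X)$. With $L^p(\mathbb R)$ norms $\|\cdot\|_p$, define $$\begin{aligned}d(X,\hat X)={}&\|y-\hat y\|_\infty+\|U-\hat U\|_\infty+\|H_\xi-\hat H_\xi\|_1+\|\alpha'\|_\infty\|UH_\xi-\hat U\hat H_\xi\|_2+\|y_\xi-\hat y_\xi\|_2+\|U_\xi-\hat U_\xi\|_2\\&+\|g_1(X)+y_\xi-g_1(\hat X)-\hat y_\xi\|_2+\|H_\xi-\hat H_\xi\|_2+\|g_2(X)-g_2(\hat X)\|_2+\|g_3(X)-g_3(\hat X)\|_2 .\end{aligned}$$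 **Claim.** Let $(u,\mu,\nu)\in\mathcal D_0^\alpha$, $X=L((u,\mu,\nu))$ and $X_{\Delta x}=L\circ P_{\Delta x}((u,\mu,\nu))$. Then, for every choice of the signs $\sigma_j=\sigma_j(\Delta x)$ in $P_{\Delta x}$, $$d(X,X_{\Delta x})\to0\qquad\text{as }\Delta x\downarrow0 .$$ -/

import Mathlib

open MeasureTheory Filter Set Topology
open scoped ENNReal

namespace HunterSaxton

/-! ## Function spaces on the real line

Sobolev functions of one variable are represented by their continuous representatives, so that all
point values below are meaningful; `deriv` is then the a.e. defined weak derivative. -/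

/-- `α ∈ W^{1,∞}(ℝ, [0, 1))`: a Lipschitz continuous function with values in `[0, 1)`. -/
def MemW1Infty (α : ℝ → ℝ) : Prop :=
  (∃ K, LipschitzWith K α) ∧ ∀ x, α x ∈ Ico (0 : ℝ) 1

/-- `f ∈ H¹(ℝ)`: `f` is square integrable and locally absolutely continuous, with square integrable
derivative. -/
def MemH1 (f : ℝ → ℝ) : Prop :=
  MemLp f 2 volume ∧ (∀ a b, AbsolutelyContinuousOnInterval f a b) ∧ MemLp (deriv f) 2 volume

/-- The function `χ⁺` of a smooth partition of unity `χ⁺ + χ⁻ = 1` with `0 ≤ χ± ≤ 1`: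
it vanishes on `(-∞, -1/2]` and equals `1` on `[1/2, ∞)`. -/
noncomputable def chiPlus (x : ℝ) : ℝ := Real.smoothTransition (x + 1 / 2)

/-- The function `χ⁻ = 1 - χ⁺`. -/
noncomputable def chiMinus (x : ℝ) : ℝ := 1 - chiPlus x

/-- `f ∈ E₂`, i.e. `f = f̄ + a χ⁺ + b χ⁻` with `f̄ ∈ H¹(ℝ)` and `a, b ∈ ℝ`. -/
def MemE2 (f : ℝ → ℝ) : Prop :=
  ∃ (g : ℝ → ℝ) (a b : ℝ), MemH1 g ∧ ∀ x, f x = g x + a * chiPlus x + b * chiMinus x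

/-- `f ∈ E₁⁰`, i.e. `f = f̄ + a χ⁺` with `f̄ ∈ L²(ℝ)` and `a ∈ ℝ`. -/
def MemE10 (f : ℝ → ℝ) : Prop :=
  ∃ (g : ℝ → ℝ) (a : ℝ), MemLp g 2 volume ∧ ∀ x, f x = g x + a * chiPlus x

/-! ## Measures and their primitive functions -/

/-- The absolutely continuous part of `μ` with respect to Lebesgue measure. -/
noncomputable def acPart (μ : Measure ℝ) : Measure ℝ :=
  volume.withDensity (μ.rnDeriv volume)

/-- The singular part of `μ` with respect to Lebesgue measure. -/
noncomputable def singPart (μ : Measure ℝ) : Measure ℝ := μ.singularPart volume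

/-- The left-continuous primitive function `x ↦ μ((-∞, x))`. -/
noncomputable def primitive (μ : Measure ℝ) (x : ℝ) : ℝ := μ.real (Iio x)

open Classical in
/-- The measure whose primitive function is `F`, for a nondecreasing left-continuous function `F`
which tends to `0` at `-∞` (see `measureOfPrimitive_Iio`). -/
noncomputable def measureOfPrimitive (F : ℝ → ℝ) : Measure ℝ :=
  if h : Monotone F then h.stieltjesFunction.measure else 0

theorem measureOfPrimitive_Iio {F : ℝ → ℝ} (hF : Monotone F)
    (hc : ∀ x, ContinuousWithinAt F (Iic x) x) (h0 : Tendsto F atBot (𝓝 0)) (x : ℝ) :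
    measureOfPrimitive F (Iio x) = ENNReal.ofReal (F x) := by
  have e : ∀ x, hF.stieltjesFunction x = Function.rightLim F x := hF.stieltjesFunction_eq
  have hl : Function.leftLim hF.stieltjesFunction x = F x := by
    have h1 : Tendsto F (𝓝[<] x) (𝓝 (Function.leftLim F x)) := hF.tendsto_leftLim x
    have h2 := leftLim_rightLim h1
    have h3 : (hF.stieltjesFunction : ℝ → ℝ) = Function.rightLim F := funext e
    rw [h3, h2]
    exact leftLim_eq_of_tendsto
      ((hc x).tendsto.mono_left (nhdsWithin_mono _ Iio_subset_Iic_self))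
  have hb : Tendsto hF.stieltjesFunction atBot (𝓝 0) := by
    have h1 : Tendsto (fun y : ℝ => F (y + 1)) atBot (𝓝 0) :=
      h0.comp (tendsto_atBot_add_const_right _ _ tendsto_id)
    refine tendsto_of_tendsto_of_tendsto_of_le_of_le h0 h1 (fun y => ?_) (fun y => ?_)
    · simp only [e]; exact hF.le_rightLim le_rfl
    · simp only [e]; exact hF.rightLim_le (by linarith)
  rw [measureOfPrimitive, dif_pos hF, StieltjesFunction.measure_Iio _ hb, hl, sub_zero]

/-! ## Eulerian coordinates -/

/-- A triplet `(u, μ, ν)`. -/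
structure Eulerian where
  u : ℝ → ℝ
  μ : Measure ℝ
  ν : Measure ℝ

/-- The set `𝒟^α` of Eulerian coordinates (which does not depend on `α`). -/
structure MemD (Z : Eulerian) : Prop where
  u_mem : MemE2 Z.u
  finite_μ : IsFiniteMeasure Z.μ
  finite_ν : IsFiniteMeasure Z.ν
  le : Z.μ ≤ Z.ν
  ac_le : acPart Z.μ ≤ acPart Z.ν
  ac_eq : acPart Z.μ = volume.withDensity (fun x => ENNReal.ofReal (deriv Z.u x ^ 2))
  μ_mem : MemE10 (primitive Z.μ)
  ν_mem : MemE10 (primitive Z.ν)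
  rnDeriv_pos : ∀ᵐ x ∂Z.ν, 0 < Z.μ.rnDeriv Z.ν x
  rnDeriv_ac : ∀ᵐ x ∂(acPart Z.ν), deriv Z.u x < 0 → (acPart Z.μ).rnDeriv (acPart Z.ν) x = 1

/-- The subset `𝒟₀^α = {(u, μ, ν) ∈ 𝒟^α : μ = ν}`. -/
def D0 : Set Eulerian := {Z | MemD Z ∧ Z.μ = Z.ν}

/-! ## Lagrangian coordinates -/

/-- A quadruplet `X = (y, U, V, H)`. -/
structure Lagrangian where
  y : ℝ → ℝ
  U : ℝ → ℝ
  V : ℝ → ℝ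
  H : ℝ → ℝ

/-- `y(ξ) = sup {x : x + ν((-∞, x)) < ξ}`. -/
noncomputable def charY (ν : Measure ℝ) (ξ : ℝ) : ℝ :=
  sSup {x : ℝ | x + primitive ν x < ξ}

/-- `H(ξ) = ξ - y(ξ)`. -/
noncomputable def charH (ν : Measure ℝ) (ξ : ℝ) : ℝ := ξ - charY ν ξ

/-- The map `L` from Eulerian to Lagrangian coordinates. -/
noncomputable def L (Z : Eulerian) : Lagrangian where
  y := charY Z.ν
  U := fun ξ => Z.u (charY Z.ν ξ)
  V := fun ξ => ∫ η in Iic ξ, (Z.μ.rnDeriv Z.ν (charY Z.ν η)).toReal * deriv (charH Z.ν) η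
  H := charH Z.ν

/-! ## The metric -/

/-- `‖α'‖_∞` as an extended nonnegative number. -/
noncomputable def normDeriv (α : ℝ → ℝ) : ℝ≥0∞ := eLpNorm (deriv α) ∞ volume

/-- `Ω_d(X) = {ξ : U_ξ(ξ) < 0}`; its complement is `Ω_c(X)`. -/
def Lagrangian.Ωd (X : Lagrangian) : Set ℝ := {ξ | deriv X.U ξ < 0}

/-- `H_∞ = lim_{ξ → ∞} H(ξ)`. -/
noncomputable def Lagrangian.Hinf (X : Lagrangian) : ℝ := limUnder atTop X.H

open Classical in
noncomputable def g1 (α : ℝ → ℝ) (X : Lagrangian) (ξ : ℝ) : ℝ :=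
  if ξ ∈ X.Ωd then (1 - α (X.y ξ)) * deriv X.V ξ else deriv X.V ξ

open Classical in
noncomputable def g2 (α : ℝ → ℝ) (X : Lagrangian) (ξ : ℝ) : ℝ :=
  if ξ ∈ X.Ωd then (normDeriv α).toReal * X.Hinf * deriv X.U ξ else 0

open Classical in
noncomputable def g3 (α : ℝ → ℝ) (X : Lagrangian) (ξ : ℝ) : ℝ :=
  if ξ ∈ X.Ωd then (normDeriv α).toReal * (X.U ξ * deriv X.U ξ) else 0

/-- `‖f‖_p` with respect to Lebesgue measure on `ℝ`. -/
noncomputable def nrm (p : ℝ≥0∞) (f : ℝ → ℝ) : ℝ≥0∞ := eLpNorm f p volume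

/-- The metric `d` on Lagrangian coordinates. It takes values in `[0, ∞]`, so that no infinite norm
is hidden by a junk value. -/
noncomputable def lagrDist (α : ℝ → ℝ) (X Y : Lagrangian) : ℝ≥0∞ :=
  nrm ∞ (fun ξ => X.y ξ - Y.y ξ) + nrm ∞ (fun ξ => X.U ξ - Y.U ξ)
    + nrm 1 (fun ξ => deriv X.H ξ - deriv Y.H ξ)
    + normDeriv α * nrm 2 (fun ξ => X.U ξ * deriv X.H ξ - Y.U ξ * deriv Y.H ξ)
    + nrm 2 (fun ξ => deriv X.y ξ - deriv Y.y ξ)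
    + nrm 2 (fun ξ => deriv X.U ξ - deriv Y.U ξ)
    + nrm 2 (fun ξ => g1 α X ξ + deriv X.y ξ - g1 α Y ξ - deriv Y.y ξ)
    + nrm 2 (fun ξ => deriv X.H ξ - deriv Y.H ξ)
    + nrm 2 (fun ξ => g2 α X ξ - g2 α Y ξ)
    + nrm 2 (fun ξ => g3 α X ξ - g3 α Y ξ)

/-! ## The projection operator

Everything refers to the uniform grid `x_i = i Δx`, `i ∈ ℤ`. -/

/-- The grid point `x_i = i Δx`. -/
noncomputable def grid (Δx : ℝ) (i : ℤ) : ℝ := i * Δx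

/-- The index `j` with `x_{2j} < x ≤ x_{2j+2}`. -/
noncomputable def cell (Δx x : ℝ) : ℤ := ⌈x / (2 * Δx)⌉ - 1

theorem cell_spec {Δx : ℝ} (h : 0 < Δx) (x : ℝ) :
    grid Δx (2 * cell Δx x) < x ∧ x ≤ grid Δx (2 * cell Δx x + 2) := by
  have h2 : (0 : ℝ) < 2 * Δx := by positivity
  have a := (lt_div_iff₀ h2).1 (sub_lt_iff_lt_add.2 (Int.ceil_lt_add_one (x / (2 * Δx))))
  have b := (div_le_iff₀ h2).1 (Int.le_ceil (x / (2 * Δx)))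
  constructor <;> simp only [grid, cell] <;> push_cast <;> nlinarith

/-- `Df_{2j} = (f(x_{2j+2}) - f(x_{2j})) / (2 Δx)`. -/
noncomputable def diffD (Δx : ℝ) (f : ℝ → ℝ) (j : ℤ) : ℝ :=
  (f (grid Δx (2 * j + 2)) - f (grid Δx (2 * j))) / (2 * Δx)

/-- `q_{2j} = √(DF_{ac,2j} - (Du_{2j})²)`. -/
noncomputable def projQ (Δx : ℝ) (Z : Eulerian) (j : ℤ) : ℝ :=
  √(diffD Δx (primitive (acPart Z.μ)) j - diffD Δx Z.u j ^ 2)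

/-- The projected wave profile `u_Δx`. On the cell `(x_{2j}, x_{2j+2}]` the sign `∓` is `-s j` and
the sign `±` is `s j`. -/
noncomputable def projU (Δx : ℝ) (s : ℤ → ℤˣ) (Z : Eulerian) (x : ℝ) : ℝ :=
  let j := cell Δx x
  let σ : ℝ := ((s j : ℤ) : ℝ)
  if x ≤ grid Δx (2 * j + 1) then
    Z.u (grid Δx (2 * j)) +
      (diffD Δx Z.u j - σ * projQ Δx Z j) * (x - grid Δx (2 * j))
  else
    Z.u (grid Δx (2 * j + 2)) +
      (diffD Δx Z.u j + σ * projQ Δx Z j) * (x - grid Δx (2 * j + 2))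

/-- The absolutely continuous part `F_{Δx,ac}` of the projected cumulative energy. -/
noncomputable def projFac (Δx : ℝ) (s : ℤ → ℤˣ) (Z : Eulerian) (x : ℝ) : ℝ :=
  let j := cell Δx x
  let σ : ℝ := ((s j : ℤ) : ℝ)
  let Fac := primitive (acPart Z.μ)
  if x ≤ grid Δx (2 * j + 1) then
    Fac (grid Δx (2 * j)) +
      (diffD Δx Z.u j - σ * projQ Δx Z j) ^ 2 * (x - grid Δx (2 * j))
  else
    1 / 2 * (Fac (grid Δx (2 * j + 2)) + Fac (grid Δx (2 * j)))
      - σ * (2 * diffD Δx Z.u j * projQ Δx Z j * Δx)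
      + (diffD Δx Z.u j + σ * projQ Δx Z j) ^ 2 * (x - grid Δx (2 * j + 1))

/-- The singular part `F_{Δx,sing}` of the projected cumulative energy. -/
noncomputable def projFsing (Δx : ℝ) (Z : Eulerian) (x : ℝ) : ℝ :=
  primitive (singPart Z.μ) (grid Δx (2 * cell Δx x + 2))

/-- The projected cumulative energy `F_Δx = G_Δx`. -/
noncomputable def projF (Δx : ℝ) (s : ℤ → ℤˣ) (Z : Eulerian) (x : ℝ) : ℝ :=
  projFac Δx s Z x + projFsing Δx Z x

/-- The projection operator `P_Δx`, with the sign choice `s`. -/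
noncomputable def P (Δx : ℝ) (s : ℤ → ℤˣ) (Z : Eulerian) : Eulerian where
  u := projU Δx s Z
  μ := measureOfPrimitive (projF Δx s Z)
  ν := measureOfPrimitive (projF Δx s Z)

end HunterSaxton

namespace HunterSaxton

/-! ## Primitives of finite measures -/

/-! Since `μ = ν`, the characteristic `y` pushes Lebesgue measure forward to `dx + dμ`
(`map_charY`). With `v = u_x` and `p` the density of `dx` with respect to `dx + dμ`, that is `p = 1
/ (1 + v²)` off the singular part and `p = 0` on it, this gives `y_ξ = p(y)`, `H_ξ = V_ξ = 1 -
p(y)`, `U_ξ = (v p)(y)`, hence `U_ξ² = y_ξ H_ξ`. All terms of the metric become expressions in these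
densities.

The projection keeps `u` and `F` at even grid points and the absolutely continuous energy of every
cell. As `y(ξ) < x` means `ξ < x + F(x)`, no even grid point separates the two characteristics
(`exists_cell_charY`). They differ by at most `2Δx`, and the velocities by `O(√Δx)` because both
profiles are Hölder-1/2 with the same constant. On a cell the projected slope has the same mean and
the same energy as `v`, whatever the signs, so its `L²` distance to `v` is at most twice that of any
piecewise constant function (`eLpNorm_sub_projV_le`); hence the slopes converge in `L²`.

Stability of `L` (`tendsto_lagrDist`) then rests on weak convergence plus convergence of norms.
Uniform convergence of `U` and `H` gives weak convergence of the derivatives, and the norms are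
Eulerian quantities: `∫ U_ξ² = ∫ (1 - 1/(1+v²)) dx` and `∫ H_ξ² = μ(ℝ) - ∫ U_ξ²`. Equal total energy
upgrades `H_ξ` to `L¹` convergence.

The delicate term is `g₁ + y_ξ = 1 - α(y) H_ξ 1_{U_ξ < 0}`, since the indicator is discontinuous in
`U_ξ`. Where the signs disagree, `U_ξ² = y_ξ H_ξ` bounds `H_ξ` by the errors already controlled,
except where `0 < y_ξ < δ` for one of the two solutions; that set corresponds to large `|v|` and is
uniformly small because the slopes converge in `L²`. The terms `g₂`, `g₃` only involve `min U_ξ 0`,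
which is continuous. -/

theorem primitive_nonneg (μ : Measure ℝ) (x : ℝ) : 0 ≤ primitive μ x := measureReal_nonneg

section Primitive

variable (μ : Measure ℝ) [IsFiniteMeasure μ]

theorem primitive_le (x : ℝ) : primitive μ x ≤ μ.real univ :=
  measureReal_mono (subset_univ _)

theorem monotone_primitive : Monotone (primitive μ) := fun _ _ h =>
  measureReal_mono (Iio_subset_Iio h)

theorem ofReal_primitive (x : ℝ) : ENNReal.ofReal (primitive μ x) = μ (Iio x) :=
  ofReal_measureReal

theorem primitive_add_real_Ico {a b : ℝ} (h : a ≤ b) :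
    primitive μ a + μ.real (Ico a b) = primitive μ b := by
  rw [primitive, primitive, ← Iio_union_Ico_eq_Iio h,
    measureReal_union ((Iio_disjoint_Ici le_rfl).mono_right Ico_subset_Ici_self) measurableSet_Ico]

theorem continuousWithinAt_primitive (x : ℝ) :
    ContinuousWithinAt (primitive μ) (Iic x) x := by
  refine continuousWithinAt_Iio_iff_Iic.1 ?_
  obtain ⟨w, hw, hwx, hlim⟩ := exists_seq_strictMono_tendsto x
  have h1 : Tendsto (fun n => μ (Iio (w n))) atTop (𝓝 (μ (⋃ n, Iio (w n)))) :=
    tendsto_measure_iUnion_atTop fun _ _ h => Iio_subset_Iio (hw.monotone h)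
  have h2 : (⋃ n, Iio (w n)) = Iio x := by
    ext z
    simp only [mem_iUnion, mem_Iio]
    refine ⟨fun ⟨n, hn⟩ => hn.trans (hwx n), fun hz => ?_⟩
    exact ((tendsto_order.1 hlim).1 z hz).exists
  rw [h2] at h1
  have h3 : Tendsto (fun n => primitive μ (w n)) atTop (𝓝 (primitive μ x)) :=
    (ENNReal.tendsto_toReal (measure_ne_top μ _)).comp h1
  -- Monotonicity guarantees that the left limit exists, so the single sequence `w` identifies it.
  have h4 := (monotone_primitive μ).tendsto_leftLim x
  have h5 : Tendsto w atTop (𝓝[<] x) :=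
    tendsto_nhdsWithin_iff.2 ⟨hlim, Eventually.of_forall hwx⟩
  rw [tendsto_nhds_unique (h4.comp h5) h3] at h4
  exact h4

theorem tendsto_primitive_atBot : Tendsto (primitive μ) atBot (𝓝 0) := by
  have h : Tendsto (fun x => μ (Iio x)) atBot (𝓝 (μ (⋂ x : ℝ, Iio x))) :=
    tendsto_measure_iInter_atBot (fun _ => measurableSet_Iio.nullMeasurableSet)
      (fun _ _ h => Iio_subset_Iio h) ⟨0, measure_ne_top _ _⟩
  have h2 : (⋂ x : ℝ, Iio x) = ∅ := by
    ext z; simpa using ⟨z, le_rfl⟩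
  rw [h2, measure_empty] at h
  simpa using! (ENNReal.tendsto_toReal ENNReal.zero_ne_top).comp h

theorem tendsto_primitive_atTop : Tendsto (primitive μ) atTop (𝓝 (μ.real univ)) := by
  have h : Tendsto (fun x => μ (Iio x)) atTop (𝓝 (μ (⋃ x : ℝ, Iio x))) :=
    tendsto_measure_iUnion_atTop (fun _ _ h => Iio_subset_Iio h)
  rw [iUnion_Iio] at h
  exact (ENNReal.tendsto_toReal (measure_ne_top _ _)).comp h

/-- Left-continuous primitives determine the mass of each `[a, b)`, and these intervals determine
the measure. This recovers a measure from its primitive without checking monotonicity of a formula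
by hand. -/
theorem measureOfPrimitive_primitive : measureOfPrimitive (primitive μ) = μ := by
  have h := fun x => measureOfPrimitive_Iio (monotone_primitive μ)
    (continuousWithinAt_primitive μ) (tendsto_primitive_atBot μ) x
  refine Measure.ext_of_Ico' _ _ (fun a b _ => ?_) fun a b hab => ?_
  · refine ((measure_mono Ico_subset_Iio_self).trans_lt ?_).ne
    rw [h]
    exact ENNReal.ofReal_lt_top
  · rw [← Iio_sdiff_Iio, measure_sdiff (Iio_subset_Iio hab.le) measurableSet_Iio.nullMeasurableSet
      (by rw [h]; exact ENNReal.ofReal_ne_top),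
      measure_sdiff (Iio_subset_Iio hab.le) measurableSet_Iio.nullMeasurableSet
      (measure_ne_top _ _), h, h, ofReal_primitive, ofReal_primitive]

end Primitive

/-! ## Characteristics -/

section Characteristics

variable (μ : Measure ℝ) [IsFiniteMeasure μ]

/-- Left continuity is what makes the strict equivalence true: if `ξ < x + F(x)`, the inequality
persists at some `z < x`, which then bounds the set from above. The facts on characteristics below
rest on this equivalence. -/
theorem charY_lt_iff {ξ x : ℝ} : charY μ ξ < x ↔ ξ < x + primitive μ x := by
  have hmono := monotone_primitive μ
  have hne : {z : ℝ | z + primitive μ z < ξ}.Nonempty :=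
    ⟨ξ - μ.real univ - 1, by have := primitive_le μ (ξ - μ.real univ - 1); simp; linarith⟩
  have hbdd : ∀ x, ξ ≤ x + primitive μ x → x ∈ upperBounds {z : ℝ | z + primitive μ z < ξ} := by
    intro x hx z hz
    by_contra! h
    have := hmono h.le
    have : z + primitive μ z < ξ := hz
    linarith
  constructor
  · intro h
    by_contra! h'
    obtain ⟨z, hz, hzx⟩ := exists_between h
    have h1 : z ∈ {z : ℝ | z + primitive μ z < ξ} := by
      have := hmono hzx.le
      simp only [mem_ofPred_eq]; linarith
    have h2 : BddAbove {z : ℝ | z + primitive μ z < ξ} :=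
      ⟨ξ, hbdd ξ (by have := primitive_nonneg μ ξ; linarith)⟩
    exact absurd (le_csSup h2 h1) (not_le.2 hz)
  · intro h
    have h1 : ∀ᶠ z in 𝓝[<] x, ξ < z + primitive μ z := by
      have := (continuousWithinAt_id.add (continuousWithinAt_primitive μ x)).tendsto.mono_left
        (nhdsWithin_mono x Iio_subset_Iic_self)
      exact this.eventually (lt_mem_nhds h)
    obtain ⟨z, hz, hzx⟩ := (h1.and self_mem_nhdsWithin).exists
    exact (csSup_le hne (hbdd z hz.le)).trans_lt hzx

theorem le_charY_iff {ξ x : ℝ} : x ≤ charY μ ξ ↔ x + primitive μ x ≤ ξ := by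
  rw [← not_lt, charY_lt_iff, not_lt]

theorem monotone_charY : Monotone (charY μ) := fun _ _ h =>
  (le_charY_iff μ).2 (((le_charY_iff μ).1 le_rfl).trans h)

theorem measurable_charY : Measurable (charY μ) := (monotone_charY μ).measurable

theorem primitive_le_charH {x ξ : ℝ} (h : x ≤ charY μ ξ) : primitive μ x ≤ charH μ ξ := by
  have := (le_charY_iff μ).1 (le_refl (charY μ ξ))
  have := monotone_primitive μ h
  rw [charH]; linarith

theorem charH_le_primitive {x ξ : ℝ} (h : charY μ ξ < x) : charH μ ξ ≤ primitive μ x := by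
  by_contra! h'
  rw [charH] at h'
  obtain ⟨z, hz, hz'⟩ := exists_between
    (lt_min h (show charY μ ξ < ξ - primitive μ x by linarith))
  have h1 := (charY_lt_iff μ).1 hz
  have h2 := monotone_primitive μ (hz'.le.trans (min_le_left _ _))
  have h3 := hz'.trans_le (min_le_right _ _)
  linarith

theorem charH_le (ξ : ℝ) : charH μ ξ ≤ μ.real univ :=
  (charH_le_primitive μ (lt_add_one _)).trans (primitive_le _ _)

theorem tendsto_charY_atTop : Tendsto (charY μ) atTop atTop := by
  refine tendsto_atTop_mono (f := fun ξ => ξ - μ.real univ) (fun ξ => ?_)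
    (tendsto_atTop_add_const_right _ _ tendsto_id)
  have := charH_le μ ξ
  rw [charH] at this; linarith

theorem tendsto_charH_atTop : Tendsto (charH μ) atTop (𝓝 (μ.real univ)) := by
  have h1 : Tendsto (fun ξ => primitive μ (charY μ ξ)) atTop (𝓝 (μ.real univ)) :=
    (tendsto_primitive_atTop μ).comp (tendsto_charY_atTop μ)
  exact tendsto_of_tendsto_of_tendsto_of_le_of_le h1 tendsto_const_nhds
    (fun ξ => primitive_le_charH μ le_rfl) (fun ξ => charH_le μ ξ)

theorem preimage_charY_Ico (a b : ℝ) :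
    charY μ ⁻¹' Ico a b = Ico (a + primitive μ a) (b + primitive μ b) := by
  ext ξ
  simp [charY_lt_iff, le_charY_iff]

/-- The preimage of `[a, b)` is `[a + F(a), b + F(b))`, whose length is `(b - a) + μ [a, b)`. -/
theorem map_charY : Measure.map (charY μ) volume = volume + μ := by
  refine (Measure.ext_of_Ico' (volume + μ) _ (fun a b _ => ?_) fun a b hab => ?_).symm
  · simp [Real.volume_Ico, measure_ne_top]
  rw [Measure.map_apply (measurable_charY μ) measurableSet_Ico, preimage_charY_Ico,
    Real.volume_Ico, Measure.add_apply, Real.volume_Ico, ← ofReal_measureReal (μ := μ),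
    ← ENNReal.ofReal_add (by linarith) measureReal_nonneg]
  have := primitive_add_real_Ico μ hab.le
  congr 1; linarith

end Characteristics

end HunterSaxton

namespace HunterSaxton

/-! ## Energy measures and their Lagrangian densities -/

/-- The energy measure `μ` of the wave profile `u` with derivative `v` is `v² dx + μs`, where `μs`
is concentrated on the complement of the set `N` of full Lebesgue measure. -/
structure EnergyDecomp (u v : ℝ → ℝ) (μ μs : Measure ℝ) (N : Set ℝ) : Prop where
  measurable : Measurable v
  memLp : MemLp v 2 volume
  finite : IsFiniteMeasure μs
  measurableSet : MeasurableSet N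
  sing_null : μs N = 0
  compl_null : volume Nᶜ = 0
  eq : μ = volume.withDensity (fun x => ENNReal.ofReal (v x ^ 2)) + μs
  ftc : ∀ a b, u b - u a = ∫ x in a..b, v x

/-- The Radon-Nikodym derivative of Lebesgue measure with respect to `dx + dμ`. -/
noncomputable def charDens (v : ℝ → ℝ) (N : Set ℝ) : ℝ → ℝ :=
  N.indicator fun x => (1 + v x ^ 2)⁻¹

section charDens

variable {v : ℝ → ℝ} {N : Set ℝ}

theorem charDens_nonneg (x : ℝ) : 0 ≤ charDens v N x :=
  indicator_nonneg (fun _ _ => by positivity) x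

theorem charDens_le_one (x : ℝ) : charDens v N x ≤ 1 := by
  refine indicator_apply_le' (fun _ => ?_) (fun _ => zero_le_one)
  exact inv_le_one_of_one_le₀ (by nlinarith [sq_nonneg (v x)])

/-- `U_ξ² = y_ξ H_ξ` in terms of densities. -/
theorem sq_mul_charDens (x : ℝ) :
    (v x * charDens v N x) ^ 2 = charDens v N x * (1 - charDens v N x) := by
  by_cases hx : x ∈ N
  · have : 1 + v x ^ 2 ≠ 0 := by positivity
    simp only [charDens, indicator_of_mem hx]
    field_simp
    ring
  · simp [charDens, hx]

theorem abs_mul_charDens_le (x : ℝ) : |v x * charDens v N x| ≤ 1 := by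
  have h := sq_mul_charDens (v := v) (N := N) x
  refine abs_le_one_iff_mul_self_le_one.2 ?_
  nlinarith [charDens_nonneg (v := v) (N := N) x, charDens_le_one (v := v) (N := N) x]

end charDens

namespace EnergyDecomp

variable {u v : ℝ → ℝ} {μ μs : Measure ℝ} {N : Set ℝ}

theorem isFiniteMeasure (D : EnergyDecomp u v μ μs N) : IsFiniteMeasure μ := by
  have := D.finite
  have h : IsFiniteMeasure (volume.withDensity fun x => ENNReal.ofReal (v x ^ 2)) :=
    isFiniteMeasure_withDensity_ofReal D.memLp.integrable_sq.2
  rw [D.eq]; infer_instance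

theorem measurable_charDens (D : EnergyDecomp u v μ μs N) : Measurable (charDens v N) :=
  ((D.measurable.pow_const 2).const_add 1).inv.indicator D.measurableSet

theorem charDens_ae_volume (D : EnergyDecomp u v μ μs N) :
    ∀ᵐ x, charDens v N x = (1 + v x ^ 2)⁻¹ := by
  have h : ∀ᵐ x, x ∈ N := by simpa [ae_iff] using! D.compl_null
  filter_upwards [h] with x hx
  simp [charDens, hx]

theorem charDens_ae_sing (D : EnergyDecomp u v μ μs N) : ∀ᵐ x ∂μs, charDens v N x = 0 := by
  have h : ∀ᵐ x ∂μs, x ∉ N := by simpa [ae_iff] using! D.sing_null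
  filter_upwards [h] with x hx
  simp [charDens, hx]

theorem withDensity_sum (D : EnergyDecomp u v μ μs N) {f : ℝ → ℝ≥0∞} (hf : Measurable f) :
    (volume + μ).withDensity f
      = volume.withDensity (fun x => f x * (1 + ENNReal.ofReal (v x ^ 2)))
        + μs.withDensity f := by
  have := D.finite
  have hv : Measurable fun x => ENNReal.ofReal (v x ^ 2) :=
    (D.measurable.pow_const 2).ennreal_ofReal
  have h1 : (fun x => f x * (1 + ENNReal.ofReal (v x ^ 2)))
      = f + (fun x => ENNReal.ofReal (v x ^ 2)) * f := by
    ext x; simp [mul_add, mul_comm]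
  rw [D.eq, withDensity_add_measure, withDensity_add_measure, ← withDensity_mul _ hv hf, h1,
    withDensity_add_left hf, add_assoc]

/-- On `N` the factor `(1 + v²)⁻¹` cancels the density of `dx + v² dx`; the value `0` off `N`
removes the singular part. -/
theorem withDensity_charDens (D : EnergyDecomp u v μ μs N) :
    (volume + μ).withDensity (fun x => ENNReal.ofReal (charDens v N x)) = volume := by
  have hs : μs.withDensity (fun x => ENNReal.ofReal (charDens v N x)) = 0 := by
    rw [withDensity_eq_zero_iff D.measurable_charDens.ennreal_ofReal.aemeasurable]
    filter_upwards [D.charDens_ae_sing] with x hx using by simp [hx]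
  rw [D.withDensity_sum D.measurable_charDens.ennreal_ofReal, hs, add_zero]
  conv_rhs => rw [← withDensity_one (μ := volume)]
  refine withDensity_congr_ae ?_
  filter_upwards [D.charDens_ae_volume] with x hx
  rw [hx, ← ENNReal.ofReal_one, ← ENNReal.ofReal_add zero_le_one (sq_nonneg _),
    ← ENNReal.ofReal_mul (by positivity), inv_mul_cancel₀ (by positivity), Pi.one_apply,
    ENNReal.ofReal_one]

theorem withDensity_one_sub_charDens (D : EnergyDecomp u v μ μs N) :
    (volume + μ).withDensity (fun x => ENNReal.ofReal (1 - charDens v N x)) = μ := by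
  have hm : Measurable fun x => ENNReal.ofReal (1 - charDens v N x) :=
    (D.measurable_charDens.const_sub 1).ennreal_ofReal
  have hs : μs.withDensity (fun x => ENNReal.ofReal (1 - charDens v N x)) = μs := by
    conv_rhs => rw [← withDensity_one (μ := μs)]
    refine withDensity_congr_ae ?_
    filter_upwards [D.charDens_ae_sing] with x hx using by simp [hx]
  rw [D.withDensity_sum hm, hs]
  conv_rhs => rw [D.eq]
  congr 1
  refine withDensity_congr_ae ?_
  filter_upwards [D.charDens_ae_volume] with x hx
  have h0 : 1 + v x ^ 2 ≠ 0 := by positivity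
  have h1 : 1 - (1 + v x ^ 2)⁻¹ = v x ^ 2 * (1 + v x ^ 2)⁻¹ := by field_simp; ring
  rw [hx, h1, ← ENNReal.ofReal_one, ← ENNReal.ofReal_add zero_le_one (sq_nonneg _),
    ← ENNReal.ofReal_mul (by positivity), mul_assoc, inv_mul_cancel₀ h0, mul_one]

/-- Change of variables along the characteristics. -/
theorem lintegral_charY (D : EnergyDecomp u v μ μs N) {f : ℝ → ℝ≥0∞} (hf : Measurable f) :
    ∫⁻ η, f (charY μ η) = ∫⁻ x, f x ∂(volume + μ) := by
  have := D.isFiniteMeasure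
  rw [← map_charY, lintegral_map hf (measurable_charY μ)]

theorem lintegral_mul_charDens (D : EnergyDecomp u v μ μs N) {f : ℝ → ℝ≥0∞} (hf : Measurable f) :
    ∫⁻ η, ENNReal.ofReal (charDens v N (charY μ η)) * f (charY μ η) = ∫⁻ x, f x := by
  have hp := D.measurable_charDens.ennreal_ofReal
  rw [D.lintegral_charY (f := fun x => ENNReal.ofReal (charDens v N x) * f x) (hp.mul hf)]
  conv_rhs => rw [← D.withDensity_charDens]
  rw [lintegral_withDensity_eq_lintegral_mul _ hp hf]; rfl

theorem lintegral_one_sub_charDens (D : EnergyDecomp u v μ μs N) {f : ℝ → ℝ≥0∞}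
    (hf : Measurable f) :
    ∫⁻ η, ENNReal.ofReal (1 - charDens v N (charY μ η)) * f (charY μ η) = ∫⁻ x, f x ∂μ := by
  have hp : Measurable fun x => ENNReal.ofReal (1 - charDens v N x) :=
    (D.measurable_charDens.const_sub 1).ennreal_ofReal
  rw [D.lintegral_charY (f := fun x => ENNReal.ofReal (1 - charDens v N x) * f x) (hp.mul hf)]
  conv_rhs => rw [← D.withDensity_one_sub_charDens]
  rw [lintegral_withDensity_eq_lintegral_mul _ hp hf]; rfl

theorem integral_charDens_mul (D : EnergyDecomp u v μ μs N) {g : ℝ → ℝ} (hg : Measurable g) :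
    ∫ η, charDens v N (charY μ η) * g (charY μ η) = ∫ x, g x := by
  have := D.isFiniteMeasure
  have hp := D.measurable_charDens
  conv_rhs => rw [← D.withDensity_charDens]
  rw [integral_withDensity_eq_integral_toReal_smul hp.ennreal_ofReal (by simp), ← map_charY,
    integral_map (measurable_charY μ).aemeasurable
      (by exact ((hp.ennreal_ofReal.ennreal_toReal).smul hg).aestronglyMeasurable)]
  simp [ENNReal.toReal_ofReal, charDens_nonneg]

/-- Atoms of `dμ` do not contribute to integrals with density `charDens`. -/
theorem ae_charY_eq (D : EnergyDecomp u v μ μs N) (c : ℝ) :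
    ∀ᵐ η, charY μ η = c → charDens v N c = 0 := by
  have := D.isFiniteMeasure
  have h := D.lintegral_mul_charDens (f := indicator {c} 1)
    (measurable_one.indicator (measurableSet_singleton c))
  rw [lintegral_indicator (measurableSet_singleton c)] at h
  simp only [Pi.one_apply, lintegral_one, Measure.restrict_apply, MeasurableSet.univ, univ_inter,
    Real.volume_singleton] at h
  rw [lintegral_eq_zero_iff' (by
    have h1 := D.measurable_charDens.comp (measurable_charY μ)
    have h2 : Measurable (({c} : Set ℝ).indicator (1 : ℝ → ℝ≥0∞)) :=
      measurable_one.indicator (measurableSet_singleton c)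
    exact (h1.ennreal_ofReal.mul (h2.comp (measurable_charY μ))).aemeasurable)] at h
  filter_upwards [h] with η hη hc
  exact le_antisymm (by simpa [hc] using! hη) (charDens_nonneg c)

/-- As `y` is only monotone, `η ∈ (a, b]` and `y(η) ∈ (y(a), y(b)]` are not equivalent. They can
differ only on the plateaus `y = y(a)` and `y = y(b)`, where the density vanishes almost everywhere
by `ae_charY_eq`. -/
theorem intervalIntegral_charY_of_le (D : EnergyDecomp u v μ μs N) {g : ℝ → ℝ} (hg : Measurable g)
    {a b : ℝ} (hab : a ≤ b) :
    ∫ η in a..b, charDens v N (charY μ η) * g (charY μ η)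
      = ∫ x in charY μ a..charY μ b, g x := by
  have := D.isFiniteMeasure
  have hm := monotone_charY μ
  rw [intervalIntegral.integral_of_le hab, intervalIntegral.integral_of_le (hm hab),
    ← integral_indicator measurableSet_Ioc, ← integral_indicator measurableSet_Ioc,
    ← D.integral_charDens_mul (hg.indicator measurableSet_Ioc)]
  refine integral_congr_ae ?_
  filter_upwards [D.ae_charY_eq (charY μ a), D.ae_charY_eq (charY μ b)] with η ha hb
  by_cases h1 : η ∈ Ioc a b
  · rw [indicator_of_mem h1]
    by_cases h2 : charY μ η ∈ Ioc (charY μ a) (charY μ b)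
    · rw [indicator_of_mem h2]
    · have h3 : charY μ η = charY μ a := by
        by_contra h3
        exact h2 ⟨lt_of_le_of_ne (hm h1.1.le) (Ne.symm h3), hm h1.2⟩
      rw [h3, ha h3, zero_mul, zero_mul]
  · rw [indicator_of_notMem h1]
    by_cases h2 : charY μ η ∈ Ioc (charY μ a) (charY μ b)
    · have h4 : a < η := by
        by_contra! h; exact absurd (hm h) (not_le.2 h2.1)
      have h5 : b ≤ η := by
        by_contra! h; exact h1 ⟨h4, h.le⟩
      have h3 : charY μ η = charY μ b := le_antisymm h2.2 (hm h5)
      rw [h3, hb h3, zero_mul]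
    · rw [indicator_of_notMem h2, mul_zero]

theorem intervalIntegral_charY (D : EnergyDecomp u v μ μs N) {g : ℝ → ℝ} (hg : Measurable g)
    (a b : ℝ) :
    ∫ η in a..b, charDens v N (charY μ η) * g (charY μ η)
      = ∫ x in charY μ a..charY μ b, g x := by
  rcases le_total a b with h | h
  · exact D.intervalIntegral_charY_of_le hg h
  · rw [intervalIntegral.integral_symm, D.intervalIntegral_charY_of_le hg h,
      ← intervalIntegral.integral_symm]

end EnergyDecomp
end HunterSaxton

namespace HunterSaxton

/-! ## Derivatives of the Lagrangian variables -/

theorem ae_hasDerivAt_of_integral_eq {f g : ℝ → ℝ} (hg : LocallyIntegrable g volume)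
    (h : ∀ a b, f b - f a = ∫ x in a..b, g x) : ∀ᵐ x, HasDerivAt f (g x) x := by
  filter_upwards [_root_.LocallyIntegrable.ae_hasDerivAt_integral hg] with x hx
  have h1 : f = fun y => f 0 + ∫ t in (0 : ℝ)..y, g t := by
    ext y; rw [← h 0 y]; ring
  rw [h1]
  exact (hx 0).const_add _

theorem lipschitzWith_one_of_integral_eq {f g : ℝ → ℝ} (hg : ∀ x, |g x| ≤ 1)
    (h : ∀ a b, f b - f a = ∫ x in a..b, g x) : LipschitzWith 1 f := by
  refine LipschitzWith.of_dist_le_mul fun a b => ?_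
  rw [Real.dist_eq, h b a, Real.dist_eq, NNReal.coe_one]
  exact intervalIntegral.norm_integral_le_of_norm_le_const (f := g) (C := 1) fun x _ => hg x

theorem locallyIntegrable_of_abs_le {g : ℝ → ℝ} {C : ℝ} (hm : Measurable g) (hg : ∀ x, |g x| ≤ C) :
    LocallyIntegrable g volume :=
  (locallyIntegrable_const C).mono hm.aestronglyMeasurable
    (Eventually.of_forall fun x => (hg x).trans (le_abs_self C))

namespace EnergyDecomp

variable {u v : ℝ → ℝ} {μ μs : Measure ℝ} {N : Set ℝ}

theorem measurable_charDens_charY (D : EnergyDecomp u v μ μs N) :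
    Measurable fun ξ => charDens v N (charY μ ξ) := by
  have := D.isFiniteMeasure
  exact D.measurable_charDens.comp (measurable_charY μ)

theorem measurable_mul_charDens_charY (D : EnergyDecomp u v μ μs N) :
    Measurable fun ξ => v (charY μ ξ) * charDens v N (charY μ ξ) := by
  have := D.isFiniteMeasure
  exact (D.measurable.mul D.measurable_charDens).comp (measurable_charY μ)

/-- This and the next two identities exhibit `y`, `H` and `U` as primitives of densities bounded by
1. Almost everywhere derivatives and Lipschitz bounds follow without any chain rule for `u ∘ y`. -/
theorem charY_sub (D : EnergyDecomp u v μ μs N) (a b : ℝ) :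
    charY μ b - charY μ a = ∫ ξ in a..b, charDens v N (charY μ ξ) := by
  simpa using (D.intervalIntegral_charY (g := fun _ => 1) measurable_const a b).symm

theorem charH_sub (D : EnergyDecomp u v μ μs N) (a b : ℝ) :
    charH μ b - charH μ a = ∫ ξ in a..b, (1 - charDens v N (charY μ ξ)) := by
  have hi : LocallyIntegrable (fun ξ => charDens v N (charY μ ξ)) volume :=
    locallyIntegrable_of_abs_le (C := 1) D.measurable_charDens_charY fun x => by
      rw [abs_of_nonneg (charDens_nonneg _)]; exact charDens_le_one _
  rw [intervalIntegral.integral_sub (by simp)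
    (hi.integrableOn_isCompact isCompact_uIcc).intervalIntegrable, ← D.charY_sub]
  simp [charH]; ring

theorem comp_charY_sub (D : EnergyDecomp u v μ μs N) (a b : ℝ) :
    u (charY μ b) - u (charY μ a)
      = ∫ ξ in a..b, v (charY μ ξ) * charDens v N (charY μ ξ) := by
  rw [D.ftc, ← D.intervalIntegral_charY D.measurable]
  simp [mul_comm]

theorem ae_deriv_charY (D : EnergyDecomp u v μ μs N) :
    ∀ᵐ ξ, deriv (charY μ) ξ = charDens v N (charY μ ξ) := by
  refine (ae_hasDerivAt_of_integral_eq (locallyIntegrable_of_abs_le (C := 1)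
    D.measurable_charDens_charY fun x => ?_) D.charY_sub).mono fun x hx => hx.deriv
  rw [abs_of_nonneg (charDens_nonneg _)]; exact charDens_le_one _

theorem abs_one_sub_charDens_le (x : ℝ) : |1 - charDens v N x| ≤ 1 := by
  rw [abs_of_nonneg (sub_nonneg.2 (charDens_le_one _))]
  linarith [charDens_nonneg (v := v) (N := N) x]

theorem ae_deriv_charH (D : EnergyDecomp u v μ μs N) :
    ∀ᵐ ξ, deriv (charH μ) ξ = 1 - charDens v N (charY μ ξ) :=
  (ae_hasDerivAt_of_integral_eq (locallyIntegrable_of_abs_le (C := 1)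
    (D.measurable_charDens_charY.const_sub 1) fun _ => abs_one_sub_charDens_le _)
    D.charH_sub).mono fun _ hx => hx.deriv

theorem ae_deriv_comp_charY (D : EnergyDecomp u v μ μs N) :
    ∀ᵐ ξ, deriv (fun ξ => u (charY μ ξ)) ξ = v (charY μ ξ) * charDens v N (charY μ ξ) :=
  (ae_hasDerivAt_of_integral_eq (locallyIntegrable_of_abs_le (C := 1)
    D.measurable_mul_charDens_charY fun _ => abs_mul_charDens_le _)
    D.comp_charY_sub).mono fun _ hx => hx.deriv

theorem lipschitzWith_charH (D : EnergyDecomp u v μ μs N) : LipschitzWith 1 (charH μ) :=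
  lipschitzWith_one_of_integral_eq (fun _ => abs_one_sub_charDens_le _) D.charH_sub

theorem lipschitzWith_comp_charY (D : EnergyDecomp u v μ μs N) :
    LipschitzWith 1 fun ξ => u (charY μ ξ) :=
  lipschitzWith_one_of_integral_eq (fun _ => abs_mul_charDens_le _) D.comp_charY_sub

/-- `∫ H_ξ dξ` is the total energy. -/
theorem lintegral_one_sub (D : EnergyDecomp u v μ μs N) :
    ∫⁻ ξ, ENNReal.ofReal (1 - charDens v N (charY μ ξ)) = μ univ := by
  simpa using D.lintegral_one_sub_charDens (f := 1) measurable_one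

theorem integrable_one_sub (D : EnergyDecomp u v μ μs N) :
    Integrable fun ξ => 1 - charDens v N (charY μ ξ) := by
  have := D.isFiniteMeasure
  refine ⟨(D.measurable_charDens_charY.const_sub 1).aestronglyMeasurable, ?_⟩
  rw [hasFiniteIntegral_iff_ofReal (Eventually.of_forall fun _ => sub_nonneg.2 (charDens_le_one _)),
    D.lintegral_one_sub]
  exact measure_lt_top _ _

theorem integral_one_sub (D : EnergyDecomp u v μ μs N) :
    ∫ ξ, (1 - charDens v N (charY μ ξ)) = μ.real univ := by
  rw [integral_eq_lintegral_of_nonneg_ae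
    (Eventually.of_forall fun _ => sub_nonneg.2 (charDens_le_one _))
    (D.measurable_charDens_charY.const_sub 1).aestronglyMeasurable, D.lintegral_one_sub]
  rfl

/-- `∫ U_ξ² dξ` in Eulerian variables. -/
theorem integral_mul_charDens_sq (D : EnergyDecomp u v μ μs N) :
    ∫ ξ, (v (charY μ ξ) * charDens v N (charY μ ξ)) ^ 2 = ∫ x, (1 - (1 + v x ^ 2)⁻¹) := by
  simp_rw [sq_mul_charDens]
  rw [D.integral_charDens_mul (g := fun x => 1 - charDens v N x)
    (D.measurable_charDens.const_sub 1)]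
  refine integral_congr_ae ?_
  filter_upwards [D.charDens_ae_volume] with x hx using by rw [hx]

theorem integrable_mul_charDens_sq (D : EnergyDecomp u v μ μs N) :
    Integrable fun ξ => (v (charY μ ξ) * charDens v N (charY μ ξ)) ^ 2 := by
  refine D.integrable_one_sub.mono
    (D.measurable_mul_charDens_charY.pow_const 2).aestronglyMeasurable
    (Eventually.of_forall fun ξ => ?_)
  have h1 := charDens_nonneg (v := v) (N := N) (charY μ ξ)
  have h2 := charDens_le_one (v := v) (N := N) (charY μ ξ)
  rw [sq_mul_charDens, Real.norm_of_nonneg (mul_nonneg h1 (by linarith)),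
    Real.norm_of_nonneg (by linarith)]
  nlinarith

theorem memLp_mul_charDens (D : EnergyDecomp u v μ μs N) :
    MemLp (fun ξ => v (charY μ ξ) * charDens v N (charY μ ξ)) 2 volume :=
  (memLp_two_iff_integrable_sq D.measurable_mul_charDens_charY.aestronglyMeasurable).2
    D.integrable_mul_charDens_sq

/-- This is `H_ξ² = H_ξ - U_ξ²`, which reduces the `L²` norm of `H_ξ` to the total energy and the
norm of `U_ξ`. -/
theorem one_sub_sq_eq (x : ℝ) :
    (1 - charDens v N x) ^ 2 = (1 - charDens v N x) - (v x * charDens v N x) ^ 2 := by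
  rw [sq_mul_charDens]; ring

theorem memLp_one_sub (D : EnergyDecomp u v μ μs N) :
    MemLp (fun ξ => 1 - charDens v N (charY μ ξ)) 2 volume := by
  refine (memLp_two_iff_integrable_sq
    (D.measurable_charDens_charY.const_sub 1).aestronglyMeasurable).2 ?_
  simp_rw [one_sub_sq_eq]
  exact D.integrable_one_sub.sub D.integrable_mul_charDens_sq

/-- `∫ H_ξ² dξ` in Eulerian variables. -/
theorem integral_one_sub_sq (D : EnergyDecomp u v μ μs N) :
    ∫ ξ, (1 - charDens v N (charY μ ξ)) ^ 2 = μ.real univ - ∫ x, (1 - (1 + v x ^ 2)⁻¹) := by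
  simp_rw [one_sub_sq_eq]
  rw [integral_sub D.integrable_one_sub D.integrable_mul_charDens_sq, D.integral_one_sub,
    D.integral_mul_charDens_sq]

/-- The measure of the set where `0 < y_ξ < δ`. -/
theorem volume_charDens_lt (D : EnergyDecomp u v μ μs N) (δ : ℝ) :
    volume {ξ | charDens v N (charY μ ξ) ∈ Ioo 0 δ}
      = ∫⁻ x in {x | (1 + v x ^ 2)⁻¹ < δ}, ENNReal.ofReal (1 + v x ^ 2) := by
  have := D.isFiniteMeasure
  have hI : MeasurableSet (charDens v N ⁻¹' Ioo 0 δ) := D.measurable_charDens measurableSet_Ioo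
  -- The weight `1 + v²` is the reciprocal of `charDens` on this set, so the Lagrangian integrand
  -- becomes an indicator.
  have hw : Measurable fun x => (charDens v N ⁻¹' Ioo 0 δ).indicator
      (fun x => ENNReal.ofReal (1 + v x ^ 2)) x :=
    ((D.measurable.pow_const 2).const_add 1).ennreal_ofReal.indicator hI
  have h1 := D.lintegral_mul_charDens hw
  have hA : MeasurableSet {x | (1 + v x ^ 2)⁻¹ < δ} :=
    measurableSet_lt ((D.measurable.pow_const 2).const_add 1).inv measurable_const
  rw [← lintegral_indicator hA]
  trans ∫⁻ x, (charDens v N ⁻¹' Ioo 0 δ).indicator (fun x => ENNReal.ofReal (1 + v x ^ 2)) x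
  · rw [← h1, show {ξ | charDens v N (charY μ ξ) ∈ Ioo 0 δ}
        = charY μ ⁻¹' (charDens v N ⁻¹' Ioo 0 δ) from rfl,
      ← lintegral_indicator_one (hI.preimage (measurable_charY μ))]
    refine lintegral_congr fun ξ => ?_
    by_cases h : charY μ ξ ∈ charDens v N ⁻¹' Ioo 0 δ
    · have hN : charY μ ξ ∈ N := by
        by_contra hN
        have := h.1
        simp [charDens, hN] at this
      rw [indicator_of_mem h, indicator_of_mem (by exact h), charDens, indicator_of_mem hN,
        ← ENNReal.ofReal_mul (by positivity), inv_mul_cancel₀ (by positivity)]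
      simp
    · rw [indicator_of_notMem h, indicator_of_notMem (by exact h), mul_zero]
  · refine lintegral_congr_ae ?_
    filter_upwards [D.charDens_ae_volume] with x hx
    have h2 : x ∈ charDens v N ⁻¹' Ioo 0 δ ↔ x ∈ {x | (1 + v x ^ 2)⁻¹ < δ} := by
      have : 0 < (1 + v x ^ 2)⁻¹ := by positivity
      simp [hx, this]
    simp only [indicator, h2]

/-- The Lagrangian energy density is `H_ξ`. -/
theorem ae_rnDeriv_mul (D : EnergyDecomp u v μ μs N) :
    ∀ᵐ ξ, (μ.rnDeriv μ (charY μ ξ)).toReal * deriv (charH μ) ξ = deriv (charH μ) ξ := by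
  have := D.isFiniteMeasure
  have hA : MeasurableSet {x | μ.rnDeriv μ x ≠ 1} :=
    (measurableSet_singleton 1).compl.preimage (Measure.measurable_rnDeriv μ μ)
  have h0 : μ {x | μ.rnDeriv μ x ≠ 1} = 0 := Measure.rnDeriv_self μ
  -- The `μ`-null set where the Radon-Nikodym derivative is not 1 may have a preimage of positive
  -- measure, but `H_ξ` vanishes almost everywhere there.
  have h1 := D.lintegral_one_sub_charDens (measurable_one.indicator hA)
  rw [lintegral_indicator_one hA, h0] at h1
  have hm := measurable_charY μ
  have h2 : Measurable fun ξ => ENNReal.ofReal (1 - charDens v N (charY μ ξ)) *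
      {x | μ.rnDeriv μ x ≠ 1}.indicator 1 (charY μ ξ) :=
    (D.measurable_charDens_charY.const_sub 1).ennreal_ofReal.mul
      ((measurable_one.indicator hA).comp hm)
  rw [lintegral_eq_zero_iff h2] at h1
  filter_upwards [h1, D.ae_deriv_charH] with ξ hξ hH
  by_cases h : μ.rnDeriv μ (charY μ ξ) = 1
  · simp [h]
  · have h2 : (1 : ℝ) - charDens v N (charY μ ξ) ≤ 0 := by simpa [h] using! hξ
    have h3 : deriv (charH μ) ξ = 0 := by
      rw [hH]; linarith [charDens_le_one (v := v) (N := N) (charY μ ξ)]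
    rw [h3, mul_zero]

/-- `V` and `H` differ by a constant, so their `deriv` agree at every point, including points of
non-differentiability. -/
theorem deriv_V (D : EnergyDecomp u v μ μs N) :
    deriv (L ⟨u, μ, μ⟩).V = deriv (charH μ) := by
  have h1 : ∀ ξ, (L ⟨u, μ, μ⟩).V ξ
      = charH μ ξ + ((∫ η in Iic 0, (1 - charDens v N (charY μ η))) - charH μ 0) := by
    intro ξ
    have h2 : (L ⟨u, μ, μ⟩).V ξ = ∫ η in Iic ξ, (1 - charDens v N (charY μ η)) := by
      refine integral_congr_ae (ae_restrict_of_ae ?_)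
      filter_upwards [D.ae_rnDeriv_mul, D.ae_deriv_charH] with η h3 h4
      rw [h3, h4]
    have h5 := D.charH_sub 0 ξ
    rw [intervalIntegral.integral_Iic_sub_Iic D.integrable_one_sub.integrableOn
      D.integrable_one_sub.integrableOn |>.symm] at h5
    rw [h2]; linarith
  ext ξ
  rw [funext h1, deriv_add_const]

theorem Hinf_eq (D : EnergyDecomp u v μ μs N) : (L ⟨u, μ, μ⟩).Hinf = μ.real univ := by
  have := D.isFiniteMeasure
  exact (tendsto_charH_atTop μ).limUnder_eq

end EnergyDecomp
end HunterSaxton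

namespace HunterSaxton

/-! ## Convergence in `L¹` and `L²` -/

theorem integrable_fun_sub {f g : ℝ → ℝ} (hf : Integrable f) (hg : Integrable g) :
    Integrable fun x => f x - g x := hf.sub hg

theorem memLp_fun_sub {p : ℝ≥0∞} {f g : ℝ → ℝ} (hf : MemLp f p volume) (hg : MemLp g p volume) :
    MemLp (fun x => f x - g x) p volume := hf.sub hg

theorem eLpNorm_two_eq_ofReal_sqrt {f : ℝ → ℝ} (hf : MemLp f 2 volume) :
    eLpNorm f 2 volume = ENNReal.ofReal √(∫ x, f x ^ 2) := by
  rw [hf.eLpNorm_eq_integral_rpow_norm (by simp) (by simp), Real.sqrt_eq_rpow]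
  simp

theorem lintegral_ofReal_sq_eq (f : ℝ → ℝ) :
    ∫⁻ x, ENNReal.ofReal (f x ^ 2) = eLpNorm f 2 volume ^ 2 := by
  have h := eLpNorm_nnreal_pow_eq_lintegral (f := f) (p := 2) (μ := volume) (by simp)
  simp only [NNReal.coe_ofNat, ENNReal.rpow_ofNat] at h
  rw [show ((2 : NNReal) : ℝ≥0∞) = 2 from rfl] at h
  rw [h]
  refine lintegral_congr fun x => ?_
  rw [← sq_abs, ENNReal.ofReal_pow (abs_nonneg _), ← Real.norm_eq_abs, ofReal_norm]

theorem abs_integral_mul_le {f g : ℝ → ℝ} (hf : MemLp f 2 volume) (hg : MemLp g 2 volume) :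
    |∫ x, f x * g x| ≤ √(∫ x, f x ^ 2) * √(∫ x, g x ^ 2) := by
  have h := integral_mul_norm_le_Lp_mul_Lq (μ := volume) (f := f) (g := g)
    (p := 2) (q := 2) (by constructor <;> norm_num) (by simpa using hf) (by simpa using hg)
  calc |∫ x, f x * g x| ≤ ∫ x, ‖f x * g x‖ := norm_integral_le_integral_norm fun x => f x * g x
    _ = ∫ x, ‖f x‖ * ‖g x‖ := by simp
    _ ≤ _ := by simpa [Real.sqrt_eq_rpow] using h

theorem integral_sub_sq {f g : ℝ → ℝ} (hf : MemLp f 2 volume) (hg : MemLp g 2 volume) :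
    ∫ x, (f x - g x) ^ 2 = (∫ x, f x ^ 2) - 2 * (∫ x, g x * f x) + ∫ x, g x ^ 2 := by
  have h1 : Integrable fun x => g x * f x := hg.integrable_mul hf
  rw [← integral_const_mul, ← integral_sub hf.integrable_sq (h1.const_mul 2),
    ← integral_add (integrable_fun_sub hf.integrable_sq (h1.const_mul 2)) hg.integrable_sq]
  exact integral_congr_ae (Eventually.of_forall fun x => by ring)

variable {ι : Type*} {l : Filter ι}

/-- Weak convergence and convergence of the norms imply strong convergence. -/
theorem tendsto_eLpNorm_two_of_weak {f : ι → ℝ → ℝ} {g : ℝ → ℝ} (hf : ∀ i, MemLp (f i) 2 volume)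
    (hg : MemLp g 2 volume)
    (hnorm : Tendsto (fun i => ∫ x, f i x ^ 2) l (𝓝 (∫ x, g x ^ 2)))
    (hweak : Tendsto (fun i => ∫ x, f i x * g x) l (𝓝 (∫ x, g x ^ 2))) :
    Tendsto (fun i => eLpNorm (fun x => g x - f i x) 2 volume) l (𝓝 0) := by
  have h1 : Tendsto (fun i => ∫ x, (g x - f i x) ^ 2) l (𝓝 0) := by
    simp_rw [fun i => integral_sub_sq hg (hf i)]
    have := ((hweak.const_mul 2).const_sub (∫ x, g x ^ 2)).add hnorm
    convert this using 2
    ring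
  have h2 : ∀ i, eLpNorm (fun x => g x - f i x) 2 volume
      = ENNReal.ofReal √(∫ x, (g x - f i x) ^ 2) := fun i =>
    eLpNorm_two_eq_ofReal_sqrt (hg.sub (hf i))
  simp_rw [h2]
  simpa using ENNReal.tendsto_ofReal (h1.sqrt)

/-- If `F i → G` uniformly and the `L²` norms of the derivatives converge, then the derivatives
converge in `L²`. -/
theorem tendsto_eLpNorm_deriv {F f : ι → ℝ → ℝ} {G g : ℝ → ℝ}
    (hF : ∀ i, LipschitzWith 1 (F i)) (hG : LipschitzWith 1 G)
    (hFf : ∀ i, ∀ᵐ x, deriv (F i) x = f i x) (hGg : ∀ᵐ x, deriv G x = g x)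
    (hf : ∀ i, MemLp (f i) 2 volume) (hg : MemLp g 2 volume)
    (hunif : ∀ ε > 0, ∀ᶠ i in l, ∀ x, |G x - F i x| ≤ ε)
    (hnorm : Tendsto (fun i => ∫ x, f i x ^ 2) l (𝓝 (∫ x, g x ^ 2))) :
    Tendsto (fun i => eLpNorm (fun x => g x - f i x) 2 volume) l (𝓝 0) := by
  refine tendsto_eLpNorm_two_of_weak hf hg hnorm ?_
  set B : ℝ := ∫ x, g x ^ 2
  have hB : 0 ≤ B := integral_nonneg fun x => sq_nonneg _
  rw [Metric.tendsto_nhds]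
  intro ε hε
  -- Eventually `‖f i - g‖₂² ≤ 2 (B + 1) + 2 B = 4 B + 2`, so replacing `g` by a smooth `ψ` with `‖g
  -- - ψ‖₂ ≤ δ` costs at most `ε / 2`.
  set δ : ℝ := ε / (2 * (√(4 * B + 2) + 1))
  have hs := Real.sqrt_nonneg (4 * B + 2)
  have hδ : 0 < δ := by positivity
  obtain ⟨ψ, hψc, hψs, hψ⟩ := hg.exist_eLpNorm_sub_le (by simp) (by simp) hδ
  have hψL : MemLp ψ 2 volume := hψs.continuous.memLp_of_hasCompactSupport hψc
  have hψ' : √(∫ x, (g x - ψ x) ^ 2) ≤ δ := by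
    have h := eLpNorm_two_eq_ofReal_sqrt (hg.sub hψL)
    rw [h] at hψ
    exact (ENNReal.ofReal_le_ofReal_iff hδ.le).1 hψ
  obtain ⟨K, hK⟩ : ∃ K, LipschitzWith K ψ :=
    hψs.lipschitzWith_of_hasCompactSupport hψc (by simp)
  -- Integration by parts against `ψ` moves the derivative off `F i` and `G`, so that uniform
  -- convergence can be used.
  have hparts : ∀ {E e : ℝ → ℝ}, LipschitzWith 1 E → (∀ᵐ x, deriv E x = e x) →
      ∫ x, e x * ψ x = ∫ x, -deriv ψ x * E x := by
    intro E e hE hEe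
    have h := hE.integral_lineDeriv_mul_eq (μ := volume) hK hψc 1
    have h1 : ∀ x, lineDeriv ℝ E x 1 = deriv E x := fun x => by
      simp [lineDeriv, deriv_comp_const_add]
    have h2 : ∀ x, lineDeriv ℝ ψ x (-1) = -deriv ψ x := fun x => by
      rw [lineDeriv_neg]
      simp [lineDeriv, deriv_comp_const_add]
    simp_rw [h1, h2] at h
    rw [← h]
    refine integral_congr_ae ?_
    filter_upwards [hEe] with x hx using by rw [hx]
  have hψ1 : Integrable (deriv ψ) :=
    (hψs.continuous_deriv (by simp)).integrable_of_hasCompactSupport hψc.deriv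
  have hint : ∀ {E : ℝ → ℝ}, LipschitzWith 1 E → Integrable fun x => -deriv ψ x * E x :=
    fun hE => (((hψs.continuous_deriv (by simp)).neg.mul hE.continuous)
      |>.integrable_of_hasCompactSupport (hψc.deriv.neg.mul_right))
  set Q : ℝ := ∫ x, |deriv ψ x|
  have hQ : 0 ≤ Q := integral_nonneg fun x => abs_nonneg _
  have hu := hunif (ε / (2 * (Q + 1))) (by positivity)
  have hn : ∀ᶠ i in l, ∫ x, f i x ^ 2 < B + 1 := hnorm.eventually (gt_mem_nhds (lt_add_one B))
  filter_upwards [hu, hn] with i hui hni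
  have e0 : (∫ x, f i x * g x) - B = ∫ x, (f i x - g x) * g x := by
    have h : Integrable fun x => f i x * g x := (hf i).integrable_mul hg
    rw [← integral_sub h hg.integrable_sq]
    exact integral_congr_ae (Eventually.of_forall fun x => by ring)
  have e1 : ∫ x, (f i x - g x) * g x
      = (∫ x, (f i x - g x) * (g x - ψ x)) + ∫ x, (f i x - g x) * ψ x := by
    have h1 : Integrable fun x => (f i x - g x) * (g x - ψ x) :=
      ((hf i).sub hg).integrable_mul (hg.sub hψL)
    have h2 : Integrable fun x => (f i x - g x) * ψ x := ((hf i).sub hg).integrable_mul hψL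
    rw [← integral_add h1 h2]
    exact integral_congr_ae (Eventually.of_forall fun x => by ring)
  have e2 : |∫ x, (f i x - g x) * (g x - ψ x)| ≤ √(4 * B + 2) * δ := by
    refine (abs_integral_mul_le ((hf i).sub hg) (hg.sub hψL)).trans ?_
    refine mul_le_mul (Real.sqrt_le_sqrt ?_) hψ' (Real.sqrt_nonneg _) hs
    calc ∫ x, (f i x - g x) ^ 2 ≤ ∫ x, (2 * f i x ^ 2 + 2 * g x ^ 2) := by
          refine integral_mono ((hf i).sub hg).integrable_sq
            (((hf i).integrable_sq.const_mul 2).add (hg.integrable_sq.const_mul 2)) fun x => ?_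
          simp only
          nlinarith [sq_nonneg (f i x + g x)]
      _ = 2 * (∫ x, f i x ^ 2) + 2 * B := by
          rw [integral_add ((hf i).integrable_sq.const_mul 2) (hg.integrable_sq.const_mul 2),
            integral_const_mul, integral_const_mul]
      _ ≤ 4 * B + 2 := by linarith
  have e3 : |∫ x, (f i x - g x) * ψ x| ≤ ε / (2 * (Q + 1)) * Q := by
    have h1 : ∫ x, (f i x - g x) * ψ x = ∫ x, deriv ψ x * (G x - F i x) := by
      have : ∫ x, (f i x - g x) * ψ x = (∫ x, f i x * ψ x) - ∫ x, g x * ψ x := by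
        have h2 : Integrable fun x => f i x * ψ x := (hf i).integrable_mul hψL
        have h3 : Integrable fun x => g x * ψ x := hg.integrable_mul hψL
        rw [← integral_sub h2 h3]
        exact integral_congr_ae (Eventually.of_forall fun x => by ring)
      rw [this, hparts (hF i) (hFf i), hparts hG hGg, ← integral_sub (hint (hF i)) (hint hG)]
      exact integral_congr_ae (Eventually.of_forall fun x => by ring)
    rw [h1, ← integral_const_mul]
    refine norm_integral_le_of_norm_le (f := fun x => deriv ψ x * (G x - F i x))
      (hψ1.abs.const_mul _) (Eventually.of_forall fun x => ?_)
    rw [norm_mul, mul_comm]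
    exact mul_le_mul_of_nonneg_right (hui x) (norm_nonneg _)
  rw [Real.dist_eq, e0, e1]
  have h4 : √(4 * B + 2) * δ ≤ ε / 2 := by
    simp only [δ]
    rw [mul_div_assoc', div_le_div_iff₀ (by positivity) (by positivity)]
    nlinarith
  have h5 : ε / (2 * (Q + 1)) * Q < ε / 2 := by
    rw [div_mul_eq_mul_div, div_lt_div_iff₀ (by positivity) (by positivity)]
    nlinarith
  exact (abs_add_le _ _).trans_lt (by linarith)

theorem tendsto_integral_min {g : ℝ → ℝ} (hg : Integrable g) (h0 : ∀ x, 0 ≤ g x) :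
    Tendsto (fun δ : ℝ => ∫ x, min (g x) δ) (𝓝[>] 0) (𝓝 0) := by
  have h : Tendsto (fun δ : ℝ => ∫ x, min (g x) δ) (𝓝[>] 0) (𝓝 (∫ _ : ℝ, (0 : ℝ))) := by
    refine tendsto_integral_filter_of_dominated_convergence g ?_ ?_ hg ?_
    · exact Eventually.of_forall fun δ =>
        hg.aestronglyMeasurable.inf aestronglyMeasurable_const
    · filter_upwards [self_mem_nhdsWithin] with δ hδ
      refine Eventually.of_forall fun x => ?_
      rw [Real.norm_of_nonneg (le_min (h0 x) (le_of_lt hδ))]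
      exact min_le_left _ _
    · refine Eventually.of_forall fun x => ?_
      have h1 : Tendsto (fun δ : ℝ => min (g x) δ) (𝓝 0) (𝓝 (min (g x) 0)) :=
        (continuous_const.min continuous_id).tendsto 0
      rw [min_eq_right (h0 x)] at h1
      exact h1.mono_left nhdsWithin_le_nhds
  simpa using h

/-- For nonnegative functions with equal integrals, `L²` convergence implies `L¹` convergence. -/
theorem tendsto_eLpNorm_one_of_two {f : ι → ℝ → ℝ} {g : ℝ → ℝ} (hf : ∀ i, Integrable (f i))
    (hg : Integrable g) (hf0 : ∀ i x, 0 ≤ f i x) (hg0 : ∀ x, 0 ≤ g x)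
    (hf2 : ∀ i, MemLp (f i) 2 volume) (hg2 : MemLp g 2 volume)
    (hint : ∀ i, ∫ x, f i x = ∫ x, g x)
    (h : Tendsto (fun i => eLpNorm (fun x => g x - f i x) 2 volume) l (𝓝 0)) :
    Tendsto (fun i => eLpNorm (fun x => g x - f i x) 1 volume) l (𝓝 0) := by
  have h1 : ∀ i, eLpNorm (fun x => g x - f i x) 1 volume
      = ENNReal.ofReal (∫ x, |g x - f i x|) := fun i => by
    rw [eLpNorm_one_eq_lintegral_enorm,
      ← ofReal_integral_norm_eq_lintegral_enorm (integrable_fun_sub hg (hf i))]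
    rfl
  have h2 : Tendsto (fun i => ∫ x, (g x - f i x) ^ 2) l (𝓝 0) := by
    have h3 : ∀ i, ∫ x, (g x - f i x) ^ 2
        = (eLpNorm (fun x => g x - f i x) 2 volume ^ 2).toReal := fun i => by
      rw [eLpNorm_two_eq_ofReal_sqrt (memLp_fun_sub hg2 (hf2 i)), ENNReal.toReal_pow,
        ENNReal.toReal_ofReal (Real.sqrt_nonneg _),
        Real.sq_sqrt (integral_nonneg fun x => sq_nonneg _)]
    simp_rw [h3]
    have h4 := (ENNReal.tendsto_toReal (by simp)).comp (ENNReal.Tendsto.pow (n := 2) h)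
    rw [zero_pow two_ne_zero, ENNReal.toReal_zero] at h4
    exact h4
  -- Equal integrals give `∫ |g - f| = 2 ∫ (g - f)⁺`. Since `f ≥ 0`, the positive part is at most
  -- `min g δ` where it is below `δ`, and at most `(g - f)² / δ` elsewhere.
  have key : ∀ i, ∀ δ > 0, ∫ x, |g x - f i x|
      ≤ 2 / δ * (∫ x, (g x - f i x) ^ 2) + 2 * ∫ x, min (g x) δ := by
    intro i δ hδ
    have hmin : Integrable fun x => min (g x) δ := by
      refine hg.mono (hg.aestronglyMeasurable.inf aestronglyMeasurable_const)
        (Eventually.of_forall fun x => ?_)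
      rw [Real.norm_of_nonneg (le_min (hg0 x) hδ.le), Real.norm_of_nonneg (hg0 x)]
      exact min_le_left _ _
    have hsq := (memLp_fun_sub hg2 (hf2 i)).integrable_sq
    have h0 : ∫ x, (g x - f i x) = 0 := by rw [integral_sub hg (hf i), hint i, sub_self]
    have h4 : ∫ x, |g x - f i x| = ∫ x, (|g x - f i x| + (g x - f i x)) := by
      rw [integral_add (integrable_fun_sub hg (hf i)).abs (integrable_fun_sub hg (hf i)),
        h0, add_zero]
    rw [h4, ← integral_const_mul, ← integral_const_mul,
      ← integral_add (hsq.const_mul _) (hmin.const_mul _)]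
    refine integral_mono ((hg.sub (hf i)).abs.add (hg.sub (hf i)))
      ((hsq.const_mul _).add (hmin.const_mul _)) fun x => ?_
    have hm : 0 ≤ min (g x) δ := le_min (hg0 x) hδ.le
    have hq : 0 ≤ 2 / δ * (g x - f i x) ^ 2 := by positivity
    simp only
    rcases le_total (g x - f i x) 0 with h5 | h5
    · rw [abs_of_nonpos h5]; linarith
    · rw [abs_of_nonneg h5]
      rcases le_total (g x - f i x) δ with h6 | h6
      · have : g x - f i x ≤ min (g x) δ := le_min (by linarith [hf0 i x]) h6
        linarith
      · have : 2 * (g x - f i x) ≤ 2 / δ * (g x - f i x) ^ 2 := by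
          rw [div_mul_eq_mul_div, le_div_iff₀ hδ]; nlinarith
        linarith
  have h6 : Tendsto (fun i => ∫ x, |g x - f i x|) l (𝓝 0) := by
    rw [Metric.tendsto_nhds]
    intro ε hε
    have h7 := (tendsto_integral_min hg hg0).eventually (gt_mem_nhds (show 0 < ε / 4 by positivity))
    obtain ⟨δ, hδ1, hδ⟩ := (h7.and self_mem_nhdsWithin).exists
    have hδ0 : 0 < δ := hδ
    have h8 := (h2.const_mul (2 / δ))
    rw [mul_zero] at h8
    filter_upwards [h8.eventually (gt_mem_nhds (show 0 < ε / 2 by positivity))] with i hi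
    rw [Real.dist_eq, sub_zero, abs_of_nonneg (integral_nonneg fun x => abs_nonneg _)]
    linarith [key i δ hδ]
  simp_rw [h1]
  simpa using ENNReal.tendsto_ofReal h6

/-- Continuity of multiplication `L^∞ × L² → L²`. -/
theorem tendsto_eLpNorm_mul_sub_mul {a : ℝ → ℝ} {a' : ι → ℝ → ℝ} {b : ℝ → ℝ} {b' : ι → ℝ → ℝ}
    (ha : MemLp a ∞ volume) (ha' : ∀ i, AEStronglyMeasurable (a' i) volume)
    (hb : MemLp b 2 volume) (hb' : ∀ i, AEStronglyMeasurable (b' i) volume)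
    (h1 : Tendsto (fun i => eLpNorm (fun x => a x - a' i x) ∞ volume) l (𝓝 0))
    (h2 : Tendsto (fun i => eLpNorm (fun x => b x - b' i x) 2 volume) l (𝓝 0)) :
    Tendsto (fun i => eLpNorm (fun x => a x * b x - a' i x * b' i x) 2 volume) l (𝓝 0) := by
  have hle : ∀ i, eLpNorm (fun x => a x * b x - a' i x * b' i x) 2 volume
      ≤ eLpNorm (fun x => a x - a' i x) ∞ volume * eLpNorm b 2 volume
        + (eLpNorm a ∞ volume + eLpNorm (fun x => a x - a' i x) ∞ volume)
          * eLpNorm (fun x => b x - b' i x) 2 volume := by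
    intro i
    have hsub := ha.aestronglyMeasurable.sub (ha' i)
    have hbsub := hb.aestronglyMeasurable.sub (hb' i)
    have e1 : (fun x => a x * b x - a' i x * b' i x)
        = (fun x => a x - a' i x) • b + a' i • (fun x => b x - b' i x) := by
      ext x; simp; ring
    have e2 : a' i = a - (fun x => a x - a' i x) := by ext x; simp
    rw [e1]
    refine (eLpNorm_add_le (hsub.smul hb.aestronglyMeasurable) ((ha' i).smul hbsub)
      (by simp)).trans (add_le_add ?_ ?_)
    · exact eLpNorm_smul_le_eLpNorm_top_mul_eLpNorm 2 hb.aestronglyMeasurable _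
    · refine (eLpNorm_smul_le_eLpNorm_top_mul_eLpNorm 2 hbsub _).trans ?_
      refine mul_le_mul_left ?_ _
      conv_lhs => rw [e2]
      exact eLpNorm_sub_le ha.aestronglyMeasurable hsub (by simp)
  refine tendsto_of_tendsto_of_tendsto_of_le_of_le tendsto_const_nhds ?_ (fun _ => zero_le) hle
  have h3 := ENNReal.Tendsto.mul_const h1 (Or.inr hb.2.ne)
  have h4 := ENNReal.Tendsto.mul (h1.const_add (eLpNorm a ∞ volume)) (Or.inr (by simp)) h2
    (Or.inr (by simpa using ha.2.ne))
  simpa using h3.add h4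

theorem tendsto_eLpNorm_top_of_uniform {f : ι → ℝ → ℝ}
    (h : ∀ ε > 0, ∀ᶠ i in l, ∀ x, |f i x| ≤ ε) :
    Tendsto (fun i => eLpNorm (f i) ∞ volume) l (𝓝 0) := by
  rw [ENNReal.tendsto_nhds_zero]
  intro ε hε
  obtain ⟨δ, hδ, hδε⟩ := ENNReal.lt_iff_exists_nnreal_btwn.1 hε
  filter_upwards [h δ (by exact_mod_cast hδ)] with i hi
  rw [eLpNorm_exponent_top]
  refine (eLpNormEssSup_le_of_ae_bound (Eventually.of_forall hi)).trans ?_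
  rw [ENNReal.ofReal_coe_nnreal]
  exact hδε.le

end HunterSaxton

namespace HunterSaxton

/-! ## Stability of the map `L` -/

/-- The part of `|t|` above the level `R / 2`. -/
noncomputable def excess (R t : ℝ) : ℝ := max (|t| - R / 2) 0

theorem excess_nonneg (R t : ℝ) : 0 ≤ excess R t := le_max_right _ _

theorem excess_le_abs {R : ℝ} (hR : 0 ≤ R) (t : ℝ) : excess R t ≤ |t| :=
  max_le (by linarith) (abs_nonneg t)

/-- The excess is 1-Lipschitz, so tail bounds pass from a limit to functions close to it in `L²`. -/
theorem excess_le_add (R s t : ℝ) : excess R s ≤ excess R t + |t - s| := by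
  have h1 := le_max_left (|t| - R / 2) 0
  have h2 := le_max_right (|t| - R / 2) 0
  have h3 := abs_sub_abs_le_abs_sub s t
  rw [abs_sub_comm] at h3
  unfold excess
  refine max_le (by linarith) (by linarith [abs_nonneg (t - s)])

theorem measurable_excess {v : ℝ → ℝ} (hv : Measurable v) (R : ℝ) :
    Measurable fun x => excess R (v x) :=
  (hv.abs.sub_const _).max measurable_const

theorem tendsto_eLpNorm_excess {v : ℝ → ℝ} (hm : Measurable v) (hv : MemLp v 2 volume) :
    Tendsto (fun R : ℝ => eLpNorm (fun x => excess R (v x)) 2 volume) atTop (𝓝 0) := by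
  have hL : ∀ R : ℝ, 0 ≤ R → MemLp (fun x => excess R (v x)) 2 volume := fun R hR =>
    hv.mono (measurable_excess hm R).aestronglyMeasurable (Eventually.of_forall fun x => by
      rw [Real.norm_of_nonneg (excess_nonneg _ _)]; exact excess_le_abs hR _)
  have h : Tendsto (fun R : ℝ => ∫ x, excess R (v x) ^ 2) atTop (𝓝 (∫ _ : ℝ, (0 : ℝ))) := by
    refine tendsto_integral_filter_of_dominated_convergence (fun x => v x ^ 2)
      (Eventually.of_forall fun R =>
        ((measurable_excess hm R).pow_const 2).aestronglyMeasurable) ?_ hv.integrable_sq ?_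
    · filter_upwards [eventually_ge_atTop 0] with R hR
      refine Eventually.of_forall fun x => ?_
      rw [Real.norm_of_nonneg (sq_nonneg _), ← sq_abs (v x)]
      exact pow_le_pow_left₀ (excess_nonneg _ _) (excess_le_abs hR _) 2
    · refine Eventually.of_forall fun x => tendsto_const_nhds.congr' ?_
      filter_upwards [eventually_ge_atTop (2 * |v x|)] with R hR
      rw [excess, max_eq_right (by linarith)]; simp
  have h1 : Tendsto (fun R : ℝ => ENNReal.ofReal √(∫ x, excess R (v x) ^ 2)) atTop (𝓝 0) := by
    simpa using ENNReal.tendsto_ofReal h.sqrt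
  refine h1.congr' ?_
  filter_upwards [eventually_ge_atTop 0] with R hR
  rw [eLpNorm_two_eq_ofReal_sqrt (hL R hR)]

/-- On this set `|w| > R ≥ 1`. Cutting at `R / 2` makes the excess at least `|w| / 2`, hence `1 + w²
≤ 2 w² ≤ 8 · excess²`. -/
theorem setLIntegral_le_excess {w : ℝ → ℝ} (hw : Measurable w) {R : ℝ} (hR : 1 ≤ R) :
    ∫⁻ x in {x | (1 + w x ^ 2)⁻¹ < (1 + R ^ 2)⁻¹}, ENNReal.ofReal (1 + w x ^ 2)
      ≤ 8 * eLpNorm (fun x => excess R (w x)) 2 volume ^ 2 := by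
  rw [← lintegral_ofReal_sq_eq, ← lintegral_const_mul' _ _ (by simp)]
  refine (setLIntegral_mono' (measurableSet_lt ((hw.pow_const 2).const_add 1).inv measurable_const)
    fun x hx => ?_).trans (setLIntegral_le_lintegral _ _)
  have h1 : R ^ 2 < w x ^ 2 := by
    have hx' : (1 + w x ^ 2)⁻¹ < (1 + R ^ 2)⁻¹ := hx
    have := (inv_lt_inv₀ (by positivity) (by positivity)).1 hx'
    linarith
  have h2 : R < |w x| := by
    rw [← sq_abs (w x)] at h1
    exact lt_of_pow_lt_pow_left₀ 2 (abs_nonneg _) h1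
  have h3 : |w x| / 2 ≤ excess R (w x) := le_trans (by linarith) (le_max_left _ _)
  rw [show (8 : ℝ≥0∞) = ENNReal.ofReal 8 by simp, ← ENNReal.ofReal_mul (by norm_num)]
  refine ENNReal.ofReal_le_ofReal ?_
  have h4 : w x ^ 2 / 4 ≤ excess R (w x) ^ 2 := by
    rw [← sq_abs (w x)]; nlinarith [abs_nonneg (w x)]
  nlinarith

variable {ι : Type*} {l : Filter ι}

/-- `0 < y_ξ < (1 + R²)⁻¹` corresponds to `|v| > R`, and the `dx + v² dx` mass of that set is
controlled by the excess. Convergence in `L²` makes it small for a cutoff `R` independent of `i`. -/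
theorem eventually_volume_charDens_lt {u v : ι → ℝ → ℝ} {μ μs : ι → Measure ℝ} {N : ι → Set ℝ}
    {w : ℝ → ℝ} (D : ∀ i, EnergyDecomp (u i) (v i) (μ i) (μs i) (N i)) (hm : Measurable w)
    (hw : MemLp w 2 volume)
    (hv : Tendsto (fun i => eLpNorm (fun x => w x - v i x) 2 volume) l (𝓝 0)) :
    ∀ ε > 0, ∃ R : ℝ, ∀ R' ≥ R, ∀ᶠ i in l,
      volume {ξ | charDens (v i) (N i) (charY (μ i) ξ) ∈ Ioo 0 (1 + R' ^ 2)⁻¹} ≤ ε := by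
  intro ε hε
  have h1 := ENNReal.Tendsto.const_mul (a := 8) (ENNReal.Tendsto.pow (n := 2)
    ((tendsto_eLpNorm_excess hm hw).add_const 0)) (Or.inr (by simp))
  simp only [add_zero, ne_eq, OfNat.ofNat_ne_zero, not_false_eq_true, zero_pow, mul_zero] at h1
  obtain ⟨R, hR⟩ :=
    ((h1.eventually (gt_mem_nhds hε)).and (eventually_ge_atTop 1)).exists_forall_of_atTop
  refine ⟨R, fun R' hR' => ?_⟩
  obtain ⟨h2, h3⟩ := hR R' hR'
  have h4 := ENNReal.Tendsto.const_mul (a := 8) (ENNReal.Tendsto.pow (n := 2)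
    (hv.const_add (eLpNorm (fun x => excess R' (w x)) 2 volume))) (Or.inr (by simp))
  rw [add_zero] at h4
  filter_upwards [h4.eventually (gt_mem_nhds h2)] with i hi
  rw [(D i).volume_charDens_lt]
  refine (setLIntegral_le_excess (D i).measurable h3).trans (le_trans ?_ hi.le)
  refine mul_le_mul_right (pow_le_pow_left' ?_ 2) _
  have h5 : Measurable fun x => |w x - v i x| := (hm.sub (D i).measurable).abs
  refine (eLpNorm_mono_real (g := fun x => excess R' (w x) + |w x - v i x|) fun x => ?_).trans ?_
  · rw [Real.norm_of_nonneg (excess_nonneg _ _)]; exact excess_le_add _ _ _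
  · refine (eLpNorm_add_le (measurable_excess hm R').aestronglyMeasurable
      h5.aestronglyMeasurable (by simp)).trans_eq ?_
    congr 1
    exact eLpNorm_norm (fun x => w x - v i x)

/-- The pointwise estimate behind the convergence of `H_ξ` on the sets `Ω_d`. Here `p`, `q` are
values of `y_ξ` and `a`, `b` are the corresponding values of `U_ξ`. -/
theorem one_sub_mul_ite_sub_le {p q a b δ : ℝ} (hδ : 0 < δ) (hp0 : 0 ≤ p)
    (hq0 : 0 ≤ q) (ha : a ^ 2 = p * (1 - p)) (hb : b ^ 2 = q * (1 - q)) :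
    ((1 - q) * ((if a < 0 then 1 else 0) - (if b < 0 then 1 else 0))) ^ 2
      ≤ δ⁻¹ * (a - b) ^ 2 + (Ioo 0 δ).indicator 1 q + δ⁻¹ * |p - q| + (Ioo 0 δ).indicator 1 p := by
  have hi : ∀ t : ℝ, 0 ≤ (Ioo 0 δ).indicator (1 : ℝ → ℝ) t := fun t =>
    indicator_nonneg (fun _ _ => zero_le_one) t
  have h1 : 0 ≤ δ⁻¹ * (a - b) ^ 2 := by positivity
  have h2 : 0 ≤ δ⁻¹ * |p - q| := by positivity
  have h3 : 0 ≤ δ⁻¹ * (a - b) ^ 2 + (Ioo 0 δ).indicator 1 q + δ⁻¹ * |p - q|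
      + (Ioo 0 δ).indicator 1 p := by linarith [hi p, hi q]
  have hmain : a < 0 ∧ 0 ≤ b ∨ 0 ≤ a ∧ b < 0 → (1 - q) ^ 2
      ≤ δ⁻¹ * (a - b) ^ 2 + (Ioo 0 δ).indicator 1 q + δ⁻¹ * |p - q|
      + (Ioo 0 δ).indicator 1 p := by
    -- For opposite signs there are three cases. If `q ≥ δ`, then `δ (1 - q) ≤ b² ≤ (a - b)²`. If `0
    -- < q < δ`, the indicator at `q` pays. If `q = 0`, then `b = 0`, so `a < 0` and `p > 0`, and
    -- either `|p - q| ≥ δ` or the indicator at `p` pays.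
    intro hs
    have h4 : (1 - q) ^ 2 ≤ 1 - q := by nlinarith
    rcases le_or_gt δ q with h5 | h5
    · have h6 : b ^ 2 ≤ (a - b) ^ 2 := by
        rcases hs with ⟨h, h'⟩ | ⟨h, h'⟩ <;> nlinarith
      have h7 : 1 - q ≤ δ⁻¹ * (a - b) ^ 2 := by
        rw [inv_mul_eq_div, le_div_iff₀ hδ]; nlinarith
      linarith [hi p, hi q]
    · rcases hq0.eq_or_lt with h6 | h6
      · have hb0 : b = 0 := by
          have : b ^ 2 = 0 := by rw [hb, ← h6]; ring
          exact pow_eq_zero_iff two_ne_zero |>.1 this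
        have ha0 : a ≠ 0 := by
          rcases hs with ⟨h, _⟩ | ⟨_, h'⟩
          · exact h.ne
          · exact absurd hb0 h'.ne
        have hpp : 0 < p := by
          refine hp0.lt_of_ne fun h => ha0 ?_
          have : a ^ 2 = 0 := by rw [ha, ← h]; ring
          exact pow_eq_zero_iff two_ne_zero |>.1 this
        rcases le_or_gt δ p with h7 | h7
        · have : 1 ≤ δ⁻¹ * |p - q| := by
            rw [← h6, sub_zero, abs_of_pos hpp, inv_mul_eq_div, le_div_iff₀ hδ]; linarith
          linarith [hi p, hi q]
        · have : (Ioo 0 δ).indicator (1 : ℝ → ℝ) p = 1 := indicator_of_mem (mem_Ioo.2 ⟨hpp, h7⟩) _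
          linarith [hi p, hi q]
      · have : (Ioo 0 δ).indicator (1 : ℝ → ℝ) q = 1 := indicator_of_mem (mem_Ioo.2 ⟨h6, h5⟩) _
        linarith [hi p, hi q]
  by_cases h4 : a < 0 <;> by_cases h5 : b < 0
  · simpa [h4, h5] using h3
  · simpa [h4, h5] using hmain (Or.inl ⟨h4, not_lt.1 h5⟩)
  · rw [if_neg h4, if_pos h5, zero_sub, mul_neg_one, neg_sq]
    exact hmain (Or.inr ⟨not_lt.1 h4, h5⟩)
  · simpa [h4, h5] using h3

theorem eLpNorm_one_sub_mul_ite_sub_sq_le {p q a b : ℝ → ℝ} {δ : ℝ} (hδ : 0 < δ)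
    (hpm : Measurable p) (hqm : Measurable q) (ham : Measurable a) (hbm : Measurable b)
    (hp0 : ∀ x, 0 ≤ p x) (hq0 : ∀ x, 0 ≤ q x)
    (ha : ∀ x, a x ^ 2 = p x * (1 - p x)) (hb : ∀ x, b x ^ 2 = q x * (1 - q x)) :
    eLpNorm (fun x => (1 - q x) * ((if a x < 0 then 1 else 0) - (if b x < 0 then 1 else 0)))
        2 volume ^ 2
      ≤ (ENNReal.ofReal δ⁻¹ * eLpNorm (fun x => a x - b x) 2 volume ^ 2
        + ENNReal.ofReal δ⁻¹ * eLpNorm (fun x => p x - q x) 1 volume)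
        + volume {x | p x ∈ Ioo 0 δ} + volume {x | q x ∈ Ioo 0 δ} := by
  have hind : ∀ {f : ℝ → ℝ}, Measurable f →
      ∫⁻ x, ENNReal.ofReal ((Ioo 0 δ).indicator 1 (f x)) = volume {x | f x ∈ Ioo 0 δ} := by
    intro f hf
    have hS : MeasurableSet {x | f x ∈ Ioo 0 δ} := hf measurableSet_Ioo
    rw [← lintegral_indicator_one hS]
    refine lintegral_congr fun x => ?_
    by_cases h : f x ∈ Ioo 0 δ
    · rw [indicator_of_mem h, indicator_of_mem (by exact h)]; simp
    · rw [indicator_of_notMem h, indicator_of_notMem (by exact h)]; simp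
  have hIm : ∀ {f : ℝ → ℝ}, Measurable f →
      Measurable fun x => ENNReal.ofReal ((Ioo 0 δ).indicator 1 (f x)) := fun hf =>
    ((measurable_one.indicator measurableSet_Ioo).comp hf).ennreal_ofReal
  have hIn : ∀ t : ℝ, 0 ≤ (Ioo 0 δ).indicator (1 : ℝ → ℝ) t := fun t =>
    indicator_nonneg (fun _ _ => zero_le_one) t
  have hm1 : Measurable fun x => ENNReal.ofReal (δ⁻¹ * (a x - b x) ^ 2) :=
    (((ham.sub hbm).pow_const 2).const_mul _).ennreal_ofReal
  have hm2 : Measurable fun x => ENNReal.ofReal (δ⁻¹ * |p x - q x|) :=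
    ((hpm.sub hqm).abs.const_mul _).ennreal_ofReal
  have e1 : ∫⁻ x, ENNReal.ofReal (δ⁻¹ * (a x - b x) ^ 2)
      = ENNReal.ofReal δ⁻¹ * eLpNorm (fun x => a x - b x) 2 volume ^ 2 := by
    rw [← lintegral_ofReal_sq_eq, ← lintegral_const_mul' _ _ (by simp)]
    exact lintegral_congr fun x => ENNReal.ofReal_mul (by positivity)
  have e2 : ∫⁻ x, ENNReal.ofReal (δ⁻¹ * |p x - q x|)
      = ENNReal.ofReal δ⁻¹ * eLpNorm (fun x => p x - q x) 1 volume := by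
    rw [eLpNorm_one_eq_lintegral_enorm, ← lintegral_const_mul' _ _ (by simp)]
    refine lintegral_congr fun x => ?_
    rw [ENNReal.ofReal_mul (by positivity), ← Real.norm_eq_abs, ofReal_norm]
  rw [← lintegral_ofReal_sq_eq, ← e1, ← e2, ← hind hpm, ← hind hqm, ← lintegral_add_left hm1,
    ← lintegral_add_left (by exact hm1.add hm2),
    ← lintegral_add_left (by exact (hm1.add hm2).add (hIm hpm))]
  refine lintegral_mono fun x => ?_
  rw [← ENNReal.ofReal_add (by positivity) (by positivity),
    ← ENNReal.ofReal_add (by positivity) (hIn _),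
    ← ENNReal.ofReal_add (add_nonneg (by positivity) (hIn _)) (hIn _)]
  refine ENNReal.ofReal_le_ofReal ?_
  linarith [one_sub_mul_ite_sub_le hδ (hp0 x) (hq0 x) (ha x) (hb x)]

section Stability

variable {u v : ℝ → ℝ} {μ μs : Measure ℝ} {N : Set ℝ}
  {u' v' : ι → ℝ → ℝ} {μ' μs' : ι → Measure ℝ} {N' : ι → Set ℝ}

/-- The integrands at `s` and `t` differ by at most `|s - t| |s + t|`, so Cauchy-Schwarz turns `L²`
convergence of the slopes into `L¹` convergence. -/
theorem tendsto_integral_one_sub_inv (D : EnergyDecomp u v μ μs N)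
    (D' : ∀ i, EnergyDecomp (u' i) (v' i) (μ' i) (μs' i) (N' i))
    (hv : Tendsto (fun i => eLpNorm (fun x => v x - v' i x) 2 volume) l (𝓝 0)) :
    Tendsto (fun i => ∫ x, (1 - (1 + v' i x ^ 2)⁻¹)) l (𝓝 (∫ x, (1 - (1 + v x ^ 2)⁻¹))) := by
  have hb : ∀ t : ℝ, 0 ≤ 1 - (1 + t ^ 2)⁻¹ ∧ 1 - (1 + t ^ 2)⁻¹ ≤ t ^ 2 := fun t => by
    have : 1 - (1 + t ^ 2)⁻¹ = t ^ 2 / (1 + t ^ 2) := by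
      have : 1 + t ^ 2 ≠ 0 := by positivity
      field_simp; ring
    rw [this]
    exact ⟨by positivity, div_le_self (sq_nonneg t) (by nlinarith [sq_nonneg t])⟩
  have hi : ∀ {w : ℝ → ℝ}, Measurable w → MemLp w 2 volume →
      Integrable fun x => 1 - (1 + w x ^ 2)⁻¹ := fun hm hw =>
    hw.integrable_sq.mono (((hm.pow_const 2).const_add 1).inv.const_sub 1).aestronglyMeasurable
      (Eventually.of_forall fun x => by
        rw [Real.norm_of_nonneg (hb _).1, Real.norm_of_nonneg (sq_nonneg _)]; exact (hb _).2)
  have hlip : ∀ s t : ℝ, |(1 - (1 + t ^ 2)⁻¹) - (1 - (1 + s ^ 2)⁻¹)| ≤ |s - t| * |s + t| := by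
    intro s t
    have e : (1 - (1 + t ^ 2)⁻¹) - (1 - (1 + s ^ 2)⁻¹)
        = (t ^ 2 - s ^ 2) / ((1 + t ^ 2) * (1 + s ^ 2)) := by
      have h1 : 1 + t ^ 2 ≠ 0 := by positivity
      have h2 : 1 + s ^ 2 ≠ 0 := by positivity
      field_simp; ring
    rw [e, abs_div, ← abs_mul, abs_of_pos (show 0 < (1 + t ^ 2) * (1 + s ^ 2) by positivity)]
    refine (div_le_self (abs_nonneg _)
      (by nlinarith [sq_nonneg s, sq_nonneg t, mul_nonneg (sq_nonneg s) (sq_nonneg t)])).trans_eq ?_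
    rw [← abs_neg]; ring_nf
  refine tendsto_integral_of_L1' _ (hi D.measurable D.memLp).aestronglyMeasurable
    (Eventually.of_forall fun i => hi (D' i).measurable (D' i).memLp) ?_
  have hle : ∀ i, eLpNorm ((fun x => 1 - (1 + v' i x ^ 2)⁻¹) - fun x => 1 - (1 + v x ^ 2)⁻¹)
      1 volume
      ≤ eLpNorm (fun x => v x - v' i x) 2 volume
        * (eLpNorm (fun x => v x - v' i x) 2 volume + 2 * eLpNorm v 2 volume) := by
    intro i
    have h1 : AEStronglyMeasurable (fun x => v x - v' i x) volume :=
      (D.measurable.sub (D' i).measurable).aestronglyMeasurable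
    have h2 : AEStronglyMeasurable (fun x => v x + v' i x) volume :=
      (D.measurable.add (D' i).measurable).aestronglyMeasurable
    have h3 := eLpNorm_smul_le_mul_eLpNorm (p := 2) (q := 2) (r := 1) h2 h1
    refine (eLpNorm_mono fun x => ?_).trans (h3.trans (mul_le_mul_right ?_ _))
    · simpa [abs_mul] using hlip (v x) (v' i x)
    · have e : (fun x => v x + v' i x) = (2 : ℝ) • v - fun x => v x - v' i x := by
        ext x; simp; ring
      have e2 : eLpNorm ((2 : ℝ) • v) 2 volume = 2 * eLpNorm v 2 volume := by
        rw [eLpNorm_const_smul, Real.enorm_eq_ofReal zero_le_two, ENNReal.ofReal_ofNat]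
      rw [e, add_comm, ← e2]
      exact eLpNorm_sub_le (D.memLp.const_smul _).aestronglyMeasurable h1 (by simp)
  refine tendsto_of_tendsto_of_tendsto_of_le_of_le tendsto_const_nhds ?_ (fun _ => zero_le) hle
  have h1 := ENNReal.Tendsto.mul hv (Or.inr (by simp [ENNReal.mul_eq_top, D.memLp.2.ne]))
    (hv.add_const (2 * eLpNorm v 2 volume)) (Or.inr (by simp))
  simpa using h1

theorem tendsto_eLpNorm_slope (D : EnergyDecomp u v μ μs N)
    (D' : ∀ i, EnergyDecomp (u' i) (v' i) (μ' i) (μs' i) (N' i))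
    (hU : ∀ ε > 0, ∀ᶠ i in l, ∀ ξ, |u (charY μ ξ) - u' i (charY (μ' i) ξ)| ≤ ε)
    (hv : Tendsto (fun i => eLpNorm (fun x => v x - v' i x) 2 volume) l (𝓝 0)) :
    Tendsto (fun i => eLpNorm (fun ξ => v (charY μ ξ) * charDens v N (charY μ ξ)
      - v' i (charY (μ' i) ξ) * charDens (v' i) (N' i) (charY (μ' i) ξ)) 2 volume) l (𝓝 0) := by
  refine tendsto_eLpNorm_deriv (fun i => (D' i).lipschitzWith_comp_charY)
    D.lipschitzWith_comp_charY (fun i => (D' i).ae_deriv_comp_charY) D.ae_deriv_comp_charY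
    (fun i => (D' i).memLp_mul_charDens) D.memLp_mul_charDens hU ?_
  simp_rw [fun i => (D' i).integral_mul_charDens_sq, D.integral_mul_charDens_sq]
  exact tendsto_integral_one_sub_inv D D' hv

theorem tendsto_eLpNorm_one_sub (D : EnergyDecomp u v μ μs N)
    (D' : ∀ i, EnergyDecomp (u' i) (v' i) (μ' i) (μs' i) (N' i))
    (hmass : ∀ i, (μ' i).real univ = μ.real univ)
    (hy : ∀ ε > 0, ∀ᶠ i in l, ∀ ξ, |charY μ ξ - charY (μ' i) ξ| ≤ ε)
    (hv : Tendsto (fun i => eLpNorm (fun x => v x - v' i x) 2 volume) l (𝓝 0)) :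
    Tendsto (fun i => eLpNorm (fun ξ => (1 - charDens v N (charY μ ξ))
      - (1 - charDens (v' i) (N' i) (charY (μ' i) ξ))) 2 volume) l (𝓝 0) := by
  refine tendsto_eLpNorm_deriv (fun i => (D' i).lipschitzWith_charH)
    D.lipschitzWith_charH (fun i => (D' i).ae_deriv_charH) D.ae_deriv_charH
    (fun i => (D' i).memLp_one_sub) D.memLp_one_sub (fun ε hε => ?_) ?_
  · filter_upwards [hy ε hε] with i hi ξ
    rw [charH, charH, sub_sub_sub_cancel_left, abs_sub_comm]
    exact hi ξ
  · simp_rw [fun i => (D' i).integral_one_sub_sq, D.integral_one_sub_sq, hmass]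
    exact (tendsto_integral_one_sub_inv D D' hv).const_sub _

theorem tendsto_eLpNorm_one_one_sub (D : EnergyDecomp u v μ μs N)
    (D' : ∀ i, EnergyDecomp (u' i) (v' i) (μ' i) (μs' i) (N' i))
    (hmass : ∀ i, (μ' i).real univ = μ.real univ)
    (hy : ∀ ε > 0, ∀ᶠ i in l, ∀ ξ, |charY μ ξ - charY (μ' i) ξ| ≤ ε)
    (hv : Tendsto (fun i => eLpNorm (fun x => v x - v' i x) 2 volume) l (𝓝 0)) :
    Tendsto (fun i => eLpNorm (fun ξ => (1 - charDens v N (charY μ ξ))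
      - (1 - charDens (v' i) (N' i) (charY (μ' i) ξ))) 1 volume) l (𝓝 0) := by
  refine tendsto_eLpNorm_one_of_two (fun i => (D' i).integrable_one_sub) D.integrable_one_sub
    (fun i x => sub_nonneg.2 (charDens_le_one _)) (fun x => sub_nonneg.2 (charDens_le_one _))
    (fun i => (D' i).memLp_one_sub) D.memLp_one_sub (fun i => ?_)
    (tendsto_eLpNorm_one_sub D D' hmass hy hv)
  rw [(D' i).integral_one_sub, D.integral_one_sub, hmass]

/-- Here `δ` is fixed first, so that both sets where `0 < y_ξ < δ` are small; only then is
convergence of `U_ξ` and `y_ξ` used, with the large but fixed factor `δ⁻¹`. -/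
theorem tendsto_eLpNorm_ite_sub_ite (D : EnergyDecomp u v μ μs N)
    (D' : ∀ i, EnergyDecomp (u' i) (v' i) (μ' i) (μs' i) (N' i))
    (hmass : ∀ i, (μ' i).real univ = μ.real univ)
    (hy : ∀ ε > 0, ∀ᶠ i in l, ∀ ξ, |charY μ ξ - charY (μ' i) ξ| ≤ ε)
    (hU : ∀ ε > 0, ∀ᶠ i in l, ∀ ξ, |u (charY μ ξ) - u' i (charY (μ' i) ξ)| ≤ ε)
    (hv : Tendsto (fun i => eLpNorm (fun x => v x - v' i x) 2 volume) l (𝓝 0)) :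
    Tendsto (fun i => eLpNorm (fun ξ => (1 - charDens (v' i) (N' i) (charY (μ' i) ξ))
      * ((if v (charY μ ξ) * charDens v N (charY μ ξ) < 0 then 1 else 0)
        - (if v' i (charY (μ' i) ξ) * charDens (v' i) (N' i) (charY (μ' i) ξ) < 0 then 1 else 0)))
      2 volume) l (𝓝 0) := by
  rw [ENNReal.tendsto_nhds_zero]
  intro ε hε
  -- The squared norm has three contributions: the two exceptional sets and the convergence errors.
  set η : ℝ≥0∞ := ε ^ 2 / 3
  have hη : 0 < η := ENNReal.div_pos (pow_ne_zero 2 hε.ne') (by simp)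
  -- The limit itself is treated as a constant family.
  obtain ⟨R₁, hR₁⟩ := eventually_volume_charDens_lt (l := l) (fun _ : ι => D) D.measurable D.memLp
    (by simpa using tendsto_const_nhds) η hη
  obtain ⟨R₂, hR₂⟩ := eventually_volume_charDens_lt D' D.measurable D.memLp hv η hη
  set R := max R₁ R₂
  set δ : ℝ := (1 + R ^ 2)⁻¹
  have hδ : 0 < δ := by positivity
  have h1 : Tendsto (fun i => ENNReal.ofReal δ⁻¹
      * eLpNorm (fun ξ => v (charY μ ξ) * charDens v N (charY μ ξ)
        - v' i (charY (μ' i) ξ) * charDens (v' i) (N' i) (charY (μ' i) ξ)) 2 volume ^ 2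
      + ENNReal.ofReal δ⁻¹ * eLpNorm (fun ξ => charDens v N (charY μ ξ)
        - charDens (v' i) (N' i) (charY (μ' i) ξ)) 1 volume) l (𝓝 0) := by
    have e : ∀ i, eLpNorm (fun ξ => charDens v N (charY μ ξ)
        - charDens (v' i) (N' i) (charY (μ' i) ξ)) 1 volume
        = eLpNorm (fun ξ => (1 - charDens v N (charY μ ξ))
          - (1 - charDens (v' i) (N' i) (charY (μ' i) ξ))) 1 volume := fun i => by
      rw [← eLpNorm_neg]
      congr 1; ext ξ; simp
    simp_rw [e]
    have h2 := ENNReal.Tendsto.const_mul (a := ENNReal.ofReal δ⁻¹)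
      (ENNReal.Tendsto.pow (n := 2) (tendsto_eLpNorm_slope D D' hU hv)) (Or.inr (by simp))
    have h3 := ENNReal.Tendsto.const_mul (a := ENNReal.ofReal δ⁻¹)
      (tendsto_eLpNorm_one_one_sub D D' hmass hy hv) (Or.inr (by simp))
    simpa using h2.add h3
  filter_upwards [hR₁ R (le_max_left _ _), hR₂ R (le_max_right _ _),
    ENNReal.tendsto_nhds_zero.1 h1 η hη] with i h2 h3 h4
  have h5 := eLpNorm_one_sub_mul_ite_sub_sq_le hδ D.measurable_charDens_charY
    (D' i).measurable_charDens_charY D.measurable_mul_charDens_charY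
    (D' i).measurable_mul_charDens_charY (fun _ => charDens_nonneg _) (fun _ => charDens_nonneg _)
    (fun _ => sq_mul_charDens _) (fun _ => sq_mul_charDens _)
  have h6 := h5.trans (add_le_add (add_le_add h4 h2) h3)
  rw [ENNReal.add_thirds] at h6
  exact (ENNReal.pow_le_pow_left_iff two_ne_zero).1 h6

end Stability

end HunterSaxton

namespace HunterSaxton

/-! ### The terms of the metric and the continuity of `L` -/

namespace EnergyDecomp

variable {u v : ℝ → ℝ} {μ μs : Measure ℝ} {N : Set ℝ}

/-- With `V_ξ = H_ξ` and `H_ξ + y_ξ = 1`, only `α(y) H_ξ 1_{U_ξ < 0}` survives; the constant 1,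
which is not square integrable, cancels in differences. -/
theorem g1_add_ae (D : EnergyDecomp u v μ μs N) (α : ℝ → ℝ) :
    ∀ᵐ ξ, g1 α (L ⟨u, μ, μ⟩) ξ + deriv (L ⟨u, μ, μ⟩).y ξ
      = 1 - α (charY μ ξ) * ((1 - charDens v N (charY μ ξ))
        * if v (charY μ ξ) * charDens v N (charY μ ξ) < 0 then 1 else 0) := by
  filter_upwards [D.ae_deriv_charH, D.ae_deriv_charY, D.ae_deriv_comp_charY] with ξ h1 h2 h3
  have h4 : ξ ∈ (L ⟨u, μ, μ⟩).Ωd ↔ v (charY μ ξ) * charDens v N (charY μ ξ) < 0 := by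
    rw [← h3]; exact Iff.rfl
  have h5 : deriv (L ⟨u, μ, μ⟩).y ξ = charDens v N (charY μ ξ) := h2
  rw [g1, D.deriv_V, h1, h5]
  simp only [h4]
  split_ifs
  · simp only [L]; ring
  · ring

/-- Restricting `U_ξ` to `Ω_d` gives `min U_ξ 0`, a 1-Lipschitz function of `U_ξ`, so the
discontinuity of the indicator plays no role here or in `g3_ae`. -/
theorem g2_ae (D : EnergyDecomp u v μ μs N) (α : ℝ → ℝ) :
    ∀ᵐ ξ, g2 α (L ⟨u, μ, μ⟩) ξ = ((normDeriv α).toReal * μ.real univ)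
      * min (v (charY μ ξ) * charDens v N (charY μ ξ)) 0 := by
  filter_upwards [D.ae_deriv_comp_charY] with ξ h3
  have h4 : ξ ∈ (L ⟨u, μ, μ⟩).Ωd ↔ v (charY μ ξ) * charDens v N (charY μ ξ) < 0 := by
    rw [← h3]; exact Iff.rfl
  have h5 : deriv (L ⟨u, μ, μ⟩).U ξ = v (charY μ ξ) * charDens v N (charY μ ξ) := h3
  rw [g2, D.Hinf_eq, h5]
  simp only [h4]
  split_ifs with h
  · rw [min_eq_left h.le]
  · rw [min_eq_right (not_lt.1 h), mul_zero]

theorem g3_ae (D : EnergyDecomp u v μ μs N) (α : ℝ → ℝ) :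
    ∀ᵐ ξ, g3 α (L ⟨u, μ, μ⟩) ξ = (normDeriv α).toReal * (u (charY μ ξ)
      * min (v (charY μ ξ) * charDens v N (charY μ ξ)) 0) := by
  filter_upwards [D.ae_deriv_comp_charY] with ξ h3
  have h4 : ξ ∈ (L ⟨u, μ, μ⟩).Ωd ↔ v (charY μ ξ) * charDens v N (charY μ ξ) < 0 := by
    rw [← h3]; exact Iff.rfl
  have h5 : deriv (L ⟨u, μ, μ⟩).U ξ = v (charY μ ξ) * charDens v N (charY μ ξ) := h3
  rw [g3, h5]
  simp only [h4]
  split_ifs with h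
  · rw [min_eq_left h.le]; rfl
  · rw [min_eq_right (not_lt.1 h), mul_zero, mul_zero]

end EnergyDecomp

variable {ι : Type*} {l : Filter ι} {u v : ℝ → ℝ} {μ μs : Measure ℝ} {N : Set ℝ}
  {u' v' : ι → ℝ → ℝ} {μ' μs' : ι → Measure ℝ} {N' : ι → Set ℝ}

theorem normDeriv_ne_top {α : ℝ → ℝ} (hα : MemW1Infty α) : normDeriv α ≠ ∞ := by
  obtain ⟨⟨K, hK⟩, -⟩ := hα
  rw [normDeriv, eLpNorm_exponent_top]
  exact ((eLpNormEssSup_le_of_ae_bound (C := K)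
    (Eventually.of_forall fun x => norm_deriv_le_of_lipschitz hK)).trans_lt
      ENNReal.ofReal_lt_top).ne

theorem tendsto_eLpNorm_min {f : ι → ℝ → ℝ} {g : ℝ → ℝ}
    (h : Tendsto (fun i => eLpNorm (fun x => g x - f i x) 2 volume) l (𝓝 0)) :
    Tendsto (fun i => eLpNorm (fun x => min (g x) 0 - min (f i x) 0) 2 volume) l (𝓝 0) :=
  tendsto_of_tendsto_of_tendsto_of_le_of_le tendsto_const_nhds h (fun _ => zero_le) fun i =>
    eLpNorm_mono fun x => by
      simpa using abs_min_sub_min_le_max (g x) 0 (f i x) 0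

/-- The map `L` is continuous in the following sense: if the energies agree, the characteristics and
the Lagrangian velocities converge uniformly and the Eulerian velocity gradients converge in `L²`,
then the Lagrangian coordinates converge with respect to the metric. -/
theorem tendsto_lagrDist {α : ℝ → ℝ} (hα : MemW1Infty α) (D : EnergyDecomp u v μ μs N)
    (D' : ∀ i, EnergyDecomp (u' i) (v' i) (μ' i) (μs' i) (N' i))
    (hmass : ∀ i, (μ' i).real univ = μ.real univ) {C : ℝ} (hC : ∀ x, |u x| ≤ C)
    (hy : ∀ ε > 0, ∀ᶠ i in l, ∀ ξ, |charY μ ξ - charY (μ' i) ξ| ≤ ε)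
    (hU : ∀ ε > 0, ∀ᶠ i in l, ∀ ξ, |u (charY μ ξ) - u' i (charY (μ' i) ξ)| ≤ ε)
    (hv : Tendsto (fun i => eLpNorm (fun x => v x - v' i x) 2 volume) l (𝓝 0)) :
    Tendsto (fun i => lagrDist α (L ⟨u, μ, μ⟩) (L ⟨u' i, μ' i, μ' i⟩)) l (𝓝 0) := by
  obtain ⟨⟨K, hK⟩, hα01⟩ := id hα
  have := D.isFiniteMeasure
  have := fun i => (D' i).isFiniteMeasure
  have hslope := tendsto_eLpNorm_slope D D' hU hv
  have hH2 := tendsto_eLpNorm_one_sub D D' hmass hy hv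
  have hH1 := tendsto_eLpNorm_one_one_sub D D' hmass hy hv
  have hite := tendsto_eLpNorm_ite_sub_ite D D' hmass hy hU hv
  have hUm : MemLp (fun ξ => u (charY μ ξ)) ∞ volume :=
    memLp_top_of_bound D.lipschitzWith_comp_charY.continuous.aestronglyMeasurable C
      (Eventually.of_forall fun ξ => hC _)
  have hUm' : ∀ i, AEStronglyMeasurable (fun ξ => u' i (charY (μ' i) ξ)) volume := fun i =>
    (D' i).lipschitzWith_comp_charY.continuous.aestronglyMeasurable
  have hUinf := tendsto_eLpNorm_top_of_uniform hU
  have t1 : Tendsto (fun i => nrm ∞ (fun ξ => (L ⟨u, μ, μ⟩).y ξ - (L ⟨u' i, μ' i, μ' i⟩).y ξ))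
      l (𝓝 0) := tendsto_eLpNorm_top_of_uniform hy
  have t2 : Tendsto (fun i => nrm ∞ (fun ξ => (L ⟨u, μ, μ⟩).U ξ - (L ⟨u' i, μ' i, μ' i⟩).U ξ))
      l (𝓝 0) := hUinf
  have eH : ∀ (p : ℝ≥0∞) i,
      nrm p (fun ξ => deriv (L ⟨u, μ, μ⟩).H ξ - deriv (L ⟨u' i, μ' i, μ' i⟩).H ξ)
        = eLpNorm (fun ξ => (1 - charDens v N (charY μ ξ))
          - (1 - charDens (v' i) (N' i) (charY (μ' i) ξ))) p volume := fun p i => by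
    refine eLpNorm_congr_ae ?_
    filter_upwards [D.ae_deriv_charH, (D' i).ae_deriv_charH] with ξ h1 h2
    exact congrArg₂ (· - ·) h1 h2
  have t3 := hH1.congr fun i => (eH 1 i).symm
  have t8 := hH2.congr fun i => (eH 2 i).symm
  have t4 : Tendsto (fun i => normDeriv α * nrm 2 (fun ξ =>
      (L ⟨u, μ, μ⟩).U ξ * deriv (L ⟨u, μ, μ⟩).H ξ
        - (L ⟨u' i, μ' i, μ' i⟩).U ξ * deriv (L ⟨u' i, μ' i, μ' i⟩).H ξ)) l (𝓝 0) := by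
    have h := tendsto_eLpNorm_mul_sub_mul hUm hUm' D.memLp_one_sub
      (fun i => (D' i).memLp_one_sub.aestronglyMeasurable) hUinf hH2
    have h' := ENNReal.Tendsto.const_mul (a := normDeriv α) h (Or.inr (normDeriv_ne_top hα))
    rw [mul_zero] at h'
    refine h'.congr fun i => ?_
    congr 1
    refine eLpNorm_congr_ae ?_
    filter_upwards [D.ae_deriv_charH, (D' i).ae_deriv_charH] with ξ h1 h2
    rw [← h1, ← h2]; rfl
  have t5 : Tendsto (fun i => nrm 2 (fun ξ =>
      deriv (L ⟨u, μ, μ⟩).y ξ - deriv (L ⟨u' i, μ' i, μ' i⟩).y ξ)) l (𝓝 0) := by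
    refine hH2.congr fun i => ?_
    rw [nrm, ← eLpNorm_neg]
    refine eLpNorm_congr_ae ?_
    filter_upwards [D.ae_deriv_charY, (D' i).ae_deriv_charY] with ξ h1 h2
    rw [Pi.neg_apply, ← h1, ← h2]
    simp only [L]; ring
  have t6 : Tendsto (fun i => nrm 2 (fun ξ =>
      deriv (L ⟨u, μ, μ⟩).U ξ - deriv (L ⟨u' i, μ' i, μ' i⟩).U ξ)) l (𝓝 0) := by
    refine hslope.congr fun i => eLpNorm_congr_ae ?_
    filter_upwards [D.ae_deriv_comp_charY, (D' i).ae_deriv_comp_charY] with ξ h1 h2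
    rw [← h1, ← h2]; rfl
  have hmin := tendsto_eLpNorm_min hslope
  have hminL : ∀ {f : ℝ → ℝ}, MemLp f 2 volume → MemLp (fun ξ => min (f ξ) 0) 2 volume := fun hf =>
    hf.mono (hf.aestronglyMeasurable.inf aestronglyMeasurable_const)
      (Eventually.of_forall fun ξ => by simpa using abs_min_sub_min_le_max (_ : ℝ) 0 0 0)
  have t9 : Tendsto (fun i => nrm 2 (fun ξ =>
      g2 α (L ⟨u, μ, μ⟩) ξ - g2 α (L ⟨u' i, μ' i, μ' i⟩) ξ)) l (𝓝 0) := by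
    set c : ℝ := (normDeriv α).toReal * μ.real univ
    have h := ENNReal.Tendsto.const_mul (a := ‖c‖ₑ) hmin (Or.inr (by simp))
    rw [mul_zero] at h
    refine h.congr fun i => ?_
    rw [← eLpNorm_const_smul]
    refine eLpNorm_congr_ae ?_
    filter_upwards [D.g2_ae α, (D' i).g2_ae α] with ξ h1 h2
    rw [h1, h2, hmass]
    simp [c]; ring
  have t10 : Tendsto (fun i => nrm 2 (fun ξ =>
      g3 α (L ⟨u, μ, μ⟩) ξ - g3 α (L ⟨u' i, μ' i, μ' i⟩) ξ)) l (𝓝 0) := by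
    have h0 := tendsto_eLpNorm_mul_sub_mul hUm hUm' (hminL D.memLp_mul_charDens)
      (fun i => (hminL (D' i).memLp_mul_charDens).aestronglyMeasurable) hUinf hmin
    have h := ENNReal.Tendsto.const_mul (a := ‖(normDeriv α).toReal‖ₑ) h0 (Or.inr (by simp))
    rw [mul_zero] at h
    refine h.congr fun i => ?_
    rw [← eLpNorm_const_smul]
    refine eLpNorm_congr_ae ?_
    filter_upwards [D.g3_ae α, (D' i).g3_ae α] with ξ h1 h2
    rw [h1, h2]
    simp; ring
  have t7 : Tendsto (fun i => nrm 2 (fun ξ => g1 α (L ⟨u, μ, μ⟩) ξ + deriv (L ⟨u, μ, μ⟩).y ξ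
      - g1 α (L ⟨u' i, μ' i, μ' i⟩) ξ - deriv (L ⟨u' i, μ' i, μ' i⟩).y ξ)) l (𝓝 0) := by
    have hαm : MemLp (fun ξ => α (charY μ ξ)) ∞ volume :=
      memLp_top_of_bound (hK.continuous.measurable.comp (measurable_charY μ)).aestronglyMeasurable 1
        (Eventually.of_forall fun ξ => by
          rw [Real.norm_of_nonneg (hα01 _).1]; exact (hα01 _).2.le)
    have hαm' : ∀ i, AEStronglyMeasurable (fun ξ => α (charY (μ' i) ξ)) volume := fun i =>
      (hK.continuous.measurable.comp (measurable_charY (μ' i))).aestronglyMeasurable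
    have hαinf : Tendsto (fun i => eLpNorm (fun ξ => α (charY μ ξ) - α (charY (μ' i) ξ)) ∞ volume)
        l (𝓝 0) := by
      refine tendsto_eLpNorm_top_of_uniform fun ε hε => ?_
      filter_upwards [hy (ε / (K + 1)) (by positivity)] with i hi ξ
      have h1 := hK.dist_le_mul (charY μ ξ) (charY (μ' i) ξ)
      rw [Real.dist_eq, Real.dist_eq] at h1
      refine h1.trans ((mul_le_mul_of_nonneg_left (hi ξ) K.coe_nonneg).trans ?_)
      rw [mul_div_assoc', div_le_iff₀ (by positivity), mul_add, mul_comm]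
      linarith
    have hφm : ∀ {f g : ℝ → ℝ}, Measurable f → Measurable g →
        Measurable fun ξ => f ξ * if g ξ < 0 then 1 else 0 := fun hf hg =>
      hf.mul
        (Measurable.ite (measurableSet_lt hg measurable_const) measurable_const measurable_const)
    have hφ := hφm (D.measurable_charDens_charY.const_sub 1) D.measurable_mul_charDens_charY
    have hφ' := fun i =>
      hφm ((D' i).measurable_charDens_charY.const_sub 1) (D' i).measurable_mul_charDens_charY
    have hφL : MemLp (fun ξ => (1 - charDens v N (charY μ ξ))
        * if v (charY μ ξ) * charDens v N (charY μ ξ) < 0 then 1 else 0) 2 volume := by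
      refine D.memLp_one_sub.mono hφ.aestronglyMeasurable (Eventually.of_forall fun ξ => ?_)
      rw [norm_mul]
      refine mul_le_of_le_one_right (norm_nonneg _) ?_
      split_ifs <;> simp
    have hφt : Tendsto (fun i => eLpNorm (fun ξ => (1 - charDens v N (charY μ ξ))
          * (if v (charY μ ξ) * charDens v N (charY μ ξ) < 0 then 1 else 0)
        - (1 - charDens (v' i) (N' i) (charY (μ' i) ξ))
          * (if v' i (charY (μ' i) ξ) * charDens (v' i) (N' i) (charY (μ' i) ξ) < 0 then 1 else 0))
        2 volume) l (𝓝 0) := by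
      -- The difference is split as `(H_ξ - H'_ξ) 1 + H'_ξ (1 - 1')`, with `1`, `1'` the indicators
      -- of the two sets `Ω_d`.
      have hsum := hH2.add hite
      rw [add_zero] at hsum
      refine tendsto_of_tendsto_of_tendsto_of_le_of_le tendsto_const_nhds hsum
        (fun _ => zero_le) fun i => ?_
      refine le_trans ?_ (add_le_add_left (eLpNorm_mono
        (f := fun ξ => ((1 - charDens v N (charY μ ξ))
          - (1 - charDens (v' i) (N' i) (charY (μ' i) ξ)))
          * (if v (charY μ ξ) * charDens v N (charY μ ξ) < 0 then 1 else 0)) fun ξ => ?_) _)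
      · refine le_trans (le_of_eq ?_) (eLpNorm_add_le ?_ ?_ (by simp))
        · congr 1; ext ξ; simp only [Pi.add_apply]; ring
        · exact (hφm ((D.measurable_charDens_charY.const_sub 1).sub
            ((D' i).measurable_charDens_charY.const_sub 1))
            D.measurable_mul_charDens_charY).aestronglyMeasurable
        · have h1 := hφm ((D' i).measurable_charDens_charY.const_sub 1)
            D.measurable_mul_charDens_charY
          simp_rw [mul_sub]
          exact (h1.sub (hφ' i)).aestronglyMeasurable
      · rw [norm_mul]
        refine mul_le_of_le_one_right (norm_nonneg _) ?_
        split_ifs <;> simp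
    have h := tendsto_eLpNorm_mul_sub_mul hαm hαm' hφL
      (fun i => (hφ' i).aestronglyMeasurable) hαinf hφt
    refine h.congr fun i => ?_
    rw [nrm, ← eLpNorm_neg]
    refine eLpNorm_congr_ae ?_
    filter_upwards [D.g1_add_ae α, (D' i).g1_add_ae α] with ξ h1 h2
    rw [sub_sub, h1, h2, Pi.neg_apply]
    ring
  have := ((((((((t1.add t2).add t3).add t4).add t5).add t6).add t7).add t8).add t9).add t10
  simpa [lagrDist] using this

end HunterSaxton

namespace HunterSaxton

/-! ## The grid -/

section Grid

variable {h : ℝ}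

theorem grid_two_mul_lt_iff (hh : 0 < h) {x : ℝ} {j : ℤ} : grid h (2 * j) < x ↔ j ≤ cell h x := by
  rw [cell, Int.le_sub_one_iff, Int.lt_ceil, lt_div_iff₀ (by positivity), grid]
  push_cast
  rw [mul_left_comm, mul_assoc]

theorem le_grid_two_mul_add_two_iff (hh : 0 < h) {x : ℝ} {j : ℤ} :
    x ≤ grid h (2 * j + 2) ↔ cell h x ≤ j := by
  rw [← not_lt, show 2 * j + 2 = 2 * (j + 1) by ring, grid_two_mul_lt_iff hh, not_le,
    Int.lt_add_one_iff]

theorem preimage_cell_singleton (hh : 0 < h) (j : ℤ) :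
    cell h ⁻¹' {j} = Ioc (grid h (2 * j)) (grid h (2 * j + 2)) := by
  ext x
  rw [mem_Ioc, grid_two_mul_lt_iff hh, le_grid_two_mul_add_two_iff hh, mem_preimage,
    mem_singleton_iff]
  omega

theorem preimage_cell_Iio (hh : 0 < h) (j : ℤ) : cell h ⁻¹' Iio j = Iic (grid h (2 * j)) := by
  ext x
  rw [mem_preimage, mem_Iio, mem_Iic, ← not_le, ← grid_two_mul_lt_iff hh, not_lt]

theorem grid_add_one (h : ℝ) (j : ℤ) : grid h (j + 1) = grid h j + h := by
  simp [grid]; ring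

theorem grid_add_two (h : ℝ) (j : ℤ) : grid h (j + 2) = grid h j + 2 * h := by
  simp [grid]; ring

theorem measurable_cell (h : ℝ) : Measurable (cell h) :=
  (measurable_from_top (f := fun n : ℤ => n - 1)).comp
    (Int.measurable_ceil.comp (measurable_id.div_const _))

theorem setLIntegral_preimage_cell (h : ℝ) (S : Set ℤ) (f : ℝ → ℝ≥0∞) :
    ∫⁻ x in cell h ⁻¹' S, f x = ∑' j : S, ∫⁻ x in cell h ⁻¹' {(j : ℤ)}, f x := by
  rw [← lintegral_iUnion (fun j => measurable_cell h (measurableSet_singleton _))]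
  · congr 2
    ext x; simp
  · intro i j hij
    refine Disjoint.preimage _ (disjoint_singleton.2 fun h => hij (Subtype.ext h))

/-- The nearest even grid point to the left of `x` (including `x` itself). -/
noncomputable def leftGrid (h x : ℝ) : ℝ := grid h (2 * ⌊x / (2 * h)⌋)

theorem measurable_leftGrid (h : ℝ) : Measurable (leftGrid h) :=
  (measurable_from_top (f := fun n : ℤ => grid h (2 * n))).comp
    (Int.measurable_floor.comp (measurable_id.div_const _))

/-- Singular mass of `[x_{2j}, x_{2j+2})` is collected at `x_{2j}`, whereas `cell` uses `(x_{2j},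
x_{2j+2}]`. This equivalence reconciles the floor and ceiling conventions with left-continuous
primitives. -/
theorem leftGrid_lt_iff (hh : 0 < h) {x z : ℝ} :
    leftGrid h z < x ↔ z < grid h (2 * cell h x + 2) := by
  rw [leftGrid, grid_two_mul_lt_iff hh, ← Int.lt_add_one_iff, Int.floor_lt,
    div_lt_iff₀ (by positivity), grid]
  push_cast
  rw [add_mul, add_mul, one_mul, mul_comm 2 (cell h x : ℝ), mul_assoc]

theorem leftGrid_lt_grid_iff (hh : 0 < h) {j : ℤ} {z : ℝ} :
    leftGrid h z < grid h (2 * j) ↔ z < grid h (2 * j) := by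
  have hc : cell h (grid h (2 * j)) = j - 1 := by
    have h1 := (le_grid_two_mul_add_two_iff hh (x := grid h (2 * j)) (j := j - 1)).1
      (by rw [show 2 * (j - 1) + 2 = 2 * j by ring])
    have h2 := (grid_two_mul_lt_iff hh (x := grid h (2 * j)) (j := j - 1)).1 (by
      rw [show 2 * j = 2 * (j - 1) + 2 by ring, grid_add_two]; linarith)
    omega
  rw [leftGrid_lt_iff hh, hc, show 2 * (j - 1) + 2 = 2 * j by ring]

theorem leftGrid_le (hh : 0 < h) (x : ℝ) : leftGrid h x ≤ x := by
  have := Int.floor_le (x / (2 * h))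
  rw [le_div_iff₀ (by positivity)] at this
  rw [leftGrid, grid]; push_cast; linarith

theorem lt_leftGrid_add (hh : 0 < h) (x : ℝ) : x < leftGrid h x + 2 * h := by
  have := Int.lt_floor_add_one (x / (2 * h))
  rw [div_lt_iff₀ (by positivity)] at this
  rw [leftGrid, grid]; push_cast; linarith

end Grid

/-! ## The projection operator -/

/-- The slope of `projU` on the left half of a cell. -/
noncomputable def slopeL (h : ℝ) (s : ℤ → ℤˣ) (Z : Eulerian) (j : ℤ) : ℝ :=
  diffD h Z.u j - ((s j : ℤ) : ℝ) * projQ h Z j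

/-- The slope of `projU` on the right half of a cell. -/
noncomputable def slopeR (h : ℝ) (s : ℤ → ℤˣ) (Z : Eulerian) (j : ℤ) : ℝ :=
  diffD h Z.u j + ((s j : ℤ) : ℝ) * projQ h Z j

/-- The derivative of `projU`. -/
noncomputable def projV (h : ℝ) (s : ℤ → ℤˣ) (Z : Eulerian) (x : ℝ) : ℝ :=
  if x ≤ grid h (2 * cell h x + 1) then slopeL h s Z (cell h x) else slopeR h s Z (cell h x)

/-- The singular part of the projected energy. -/
noncomputable def projSing (h : ℝ) (Z : Eulerian) : Measure ℝ :=
  (singPart Z.μ).map (leftGrid h)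

/-- The projected energy. -/
noncomputable def projMeasure (h : ℝ) (s : ℤ → ℤˣ) (Z : Eulerian) : Measure ℝ :=
  volume.withDensity (fun x => ENNReal.ofReal (projV h s Z x ^ 2)) + projSing h Z

theorem measurable_projV (h : ℝ) (s : ℤ → ℤˣ) (Z : Eulerian) : Measurable (projV h s Z) := by
  have hc := measurable_cell h
  refine Measurable.ite (measurableSet_le measurable_id ?_) ?_ ?_
  · exact (measurable_from_top (f := fun j : ℤ => grid h (2 * j + 1))).comp hc
  · exact (measurable_from_top (f := slopeL h s Z)).comp hc
  · exact (measurable_from_top (f := slopeR h s Z)).comp hc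

section Cell

variable {h : ℝ}

theorem projV_of_mem_left (hh : 0 < h) (s : ℤ → ℤˣ) (Z : Eulerian) (j : ℤ)
    {x : ℝ} (hx : x ∈ Ioc (grid h (2 * j)) (grid h (2 * j) + h)) :
    projV h s Z x = slopeL h s Z j := by
  have hc : cell h x = j := by
    have : x ∈ cell h ⁻¹' {j} := by
      rw [preimage_cell_singleton hh, grid_add_two]
      exact ⟨hx.1, hx.2.trans (by linarith)⟩
    exact this
  rw [projV, hc, if_pos (by rw [grid_add_one]; exact hx.2)]

theorem projV_of_mem_right (hh : 0 < h) (s : ℤ → ℤˣ) (Z : Eulerian) (j : ℤ)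
    {x : ℝ}
    (hx : x ∈ Ioc (grid h (2 * j) + h) (grid h (2 * j) + 2 * h)) :
    projV h s Z x = slopeR h s Z j := by
  have hc : cell h x = j := by
    have : x ∈ cell h ⁻¹' {j} := by
      rw [preimage_cell_singleton hh, grid_add_two]
      exact ⟨by linarith [hx.1], hx.2⟩
    exact this
  rw [projV, hc, if_neg (by rw [grid_add_one]; exact not_le.2 hx.1)]

theorem setLIntegral_projV_left (hh : 0 < h) (s : ℤ → ℤˣ) (Z : Eulerian) (j : ℤ)
    (φ : ℝ → ℝ≥0∞) {x : ℝ} (hx : x ≤ grid h (2 * j) + h) :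
    ∫⁻ t in Ioc (grid h (2 * j)) x, φ (projV h s Z t)
      = φ (slopeL h s Z j) * ENNReal.ofReal (x - grid h (2 * j)) := by
  rw [setLIntegral_congr_fun (g := fun _ => φ (slopeL h s Z j)) measurableSet_Ioc fun t ht => by
    simp only; rw [projV_of_mem_left hh s Z j ⟨ht.1, ht.2.trans hx⟩]]
  rw [setLIntegral_const, Real.volume_Ioc]

theorem setLIntegral_projV_right (hh : 0 < h) (s : ℤ → ℤˣ) (Z : Eulerian) (j : ℤ)
    (φ : ℝ → ℝ≥0∞) {x : ℝ} (hx : grid h (2 * j) + h ≤ x)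
    (hx' : x ≤ grid h (2 * j) + 2 * h) :
    ∫⁻ t in Ioc (grid h (2 * j)) x, φ (projV h s Z t)
      = φ (slopeL h s Z j) * ENNReal.ofReal h
        + φ (slopeR h s Z j) * ENNReal.ofReal (x - (grid h (2 * j) + h)) := by
  rw [← Ioc_union_Ioc_eq_Ioc (by linarith : grid h (2 * j) ≤ grid h (2 * j) + h) hx,
    lintegral_union measurableSet_Ioc (Ioc_disjoint_Ioc_of_le le_rfl),
    setLIntegral_projV_left hh s Z j φ le_rfl]
  congr 1
  · rw [add_sub_cancel_left]
  · rw [setLIntegral_congr_fun (g := fun _ => φ (slopeR h s Z j)) measurableSet_Ioc fun t ht => by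
      simp only; rw [projV_of_mem_right hh s Z j ⟨ht.1, ht.2.trans hx'⟩]]
    rw [setLIntegral_const, Real.volume_Ioc]

end Cell

/-- The cross terms cancel and `σ² = 1`, so the energy of a cell does not depend on the sign. -/
theorem sq_slopeL_add_sq_slopeR (h : ℝ) (s : ℤ → ℤˣ) (Z : Eulerian) (j : ℤ) :
    slopeL h s Z j ^ 2 + slopeR h s Z j ^ 2 = 2 * (diffD h Z.u j ^ 2 + projQ h Z j ^ 2) := by
  have h1 : (((s j : ℤ) : ℝ)) ^ 2 = 1 := by
    rcases Int.units_eq_one_or (s j) with h | h <;> simp [h]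
  rw [slopeL, slopeR]
  linear_combination 2 * projQ h Z j ^ 2 * h1

end HunterSaxton

namespace HunterSaxton

/-! ### Conservation of energy on cells -/

section Projection

variable {h : ℝ} {s : ℤ → ℤˣ} {Z : Eulerian} {v : ℝ → ℝ} {N : Set ℝ}

theorem EnergyDecomp.intervalIntegrable {u : ℝ → ℝ} {μ μs : Measure ℝ}
    (D : EnergyDecomp u v μ μs N) (a b : ℝ) : IntervalIntegrable v volume a b :=
  ((D.memLp.locallyIntegrable (by simp)).integrableOn_isCompact isCompact_uIcc).intervalIntegrable

theorem EnergyDecomp.intervalIntegrable_sq {u : ℝ → ℝ} {μ μs : Measure ℝ}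
    (D : EnergyDecomp u v μ μs N) (a b : ℝ) :
    IntervalIntegrable (fun x => v x ^ 2) volume a b :=
  D.memLp.integrable_sq.intervalIntegrable

theorem EnergyDecomp.integral_sub_const_sq {u : ℝ → ℝ} {μ μs : Measure ℝ}
    (D : EnergyDecomp u v μ μs N) (a b c : ℝ) :
    ∫ x in a..b, (v x - c) ^ 2
      = (∫ x in a..b, v x ^ 2) - 2 * c * (u b - u a) + c ^ 2 * (b - a) := by
  have h1 : ∀ x, (v x - c) ^ 2 = v x ^ 2 - 2 * c * v x + c ^ 2 := fun x => by ring
  simp_rw [h1]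
  rw [intervalIntegral.integral_add ((D.intervalIntegrable_sq a b).sub
      ((D.intervalIntegrable a b).const_mul _)) (by simp),
    intervalIntegral.integral_sub (D.intervalIntegrable_sq a b)
      ((D.intervalIntegrable a b).const_mul _), intervalIntegral.integral_const_mul, D.ftc]
  simp; ring

/-- Cauchy-Schwarz, from nonnegativity of the variance of `v` about its mean. It yields both the
nonnegative radicand of `projQ` and the Hölder-1/2 bound on `u`. -/
theorem EnergyDecomp.sq_sub_le {u : ℝ → ℝ} {μ μs : Measure ℝ} (D : EnergyDecomp u v μ μs N)
    {a b : ℝ} (hab : a ≤ b) : (u b - u a) ^ 2 ≤ (b - a) * ∫ x in a..b, v x ^ 2 := by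
  rcases hab.eq_or_lt with rfl | hlt
  · simp
  have hba : 0 < b - a := sub_pos.2 hlt
  have h1 : 0 ≤ ∫ x in a..b, (v x - (u b - u a) / (b - a)) ^ 2 :=
    intervalIntegral.integral_nonneg hab fun x _ => sq_nonneg _
  rw [D.integral_sub_const_sq] at h1
  have h2 : (∫ x in a..b, v x ^ 2) - 2 * ((u b - u a) / (b - a)) * (u b - u a)
      + ((u b - u a) / (b - a)) ^ 2 * (b - a)
      = ((b - a) * (∫ x in a..b, v x ^ 2) - (u b - u a) ^ 2) / (b - a) := by
    field_simp; ring
  rw [h2, le_div_iff₀ hba, zero_mul] at h1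
  linarith

theorem EnergyDecomp.abs_sub_le {u : ℝ → ℝ} {μ μs : Measure ℝ} (D : EnergyDecomp u v μ μs N)
    {a b : ℝ} (hab : a ≤ b) : |u b - u a| ≤ √((b - a) * ∫ x, v x ^ 2) := by
  refine Real.abs_le_sqrt ((D.sq_sub_le hab).trans ?_)
  refine mul_le_mul_of_nonneg_left ?_ (by linarith)
  rw [intervalIntegral.integral_of_le hab]
  exact setIntegral_le_integral D.memLp.integrable_sq (Eventually.of_forall fun x => sq_nonneg _)

theorem primitive_acPart_sub
    (D : EnergyDecomp Z.u v Z.μ (singPart Z.μ) N)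
    (hac : acPart Z.μ = volume.withDensity fun x => ENNReal.ofReal (v x ^ 2)) {a b : ℝ}
    (hab : a ≤ b) :
    primitive (acPart Z.μ) b - primitive (acPart Z.μ) a = ∫ x in a..b, v x ^ 2 := by
  have hfin : IsFiniteMeasure (acPart Z.μ) := by
    rw [hac]; exact isFiniteMeasure_withDensity_ofReal D.memLp.integrable_sq.2
  rw [← primitive_add_real_Ico _ hab, add_sub_cancel_left, intervalIntegral.integral_of_le hab,
    measureReal_def, hac, withDensity_apply _ measurableSet_Ico,
    integral_eq_lintegral_of_nonneg_ae (Eventually.of_forall fun x => sq_nonneg _)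
      (D.measurable.pow_const 2).aestronglyMeasurable,
    Measure.restrict_congr_set Ico_ae_eq_Ioc]

/-- Mean values of the energy density over a cell. -/
theorem two_mul_diffD_primitive
    (D : EnergyDecomp Z.u v Z.μ (singPart Z.μ) N)
    (hac : acPart Z.μ = volume.withDensity fun x => ENNReal.ofReal (v x ^ 2)) (hh : 0 < h)
    (j : ℤ) :
    2 * h * diffD h (primitive (acPart Z.μ)) j
      = ∫ x in grid h (2 * j)..grid h (2 * j + 2), v x ^ 2 := by
  rw [← primitive_acPart_sub D hac (by rw [grid_add_two]; linarith), diffD]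
  field_simp

theorem two_mul_diffD (hh : 0 < h) (f : ℝ → ℝ) (j : ℤ) :
    2 * h * diffD h f j = f (grid h (2 * j + 2)) - f (grid h (2 * j)) := by
  rw [diffD]; field_simp

theorem projQ_sq
    (D : EnergyDecomp Z.u v Z.μ (singPart Z.μ) N)
    (hac : acPart Z.μ = volume.withDensity fun x => ENNReal.ofReal (v x ^ 2)) (hh : 0 < h)
    (j : ℤ) :
    projQ h Z j ^ 2 = diffD h (primitive (acPart Z.μ)) j - diffD h Z.u j ^ 2 := by
  rw [projQ, Real.sq_sqrt]
  have hle : grid h (2 * j) ≤ grid h (2 * j + 2) := by rw [grid_add_two]; linarith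
  have h1 := D.sq_sub_le hle
  rw [← two_mul_diffD_primitive D hac hh, ← two_mul_diffD hh, grid_add_two,
    add_sub_cancel_left] at h1
  have h2 : 0 < (2 * h) ^ 2 := by positivity
  by_contra! h3
  nlinarith

theorem sq_slopeL_add_sq_slopeR_eq
    (D : EnergyDecomp Z.u v Z.μ (singPart Z.μ) N)
    (hac : acPart Z.μ = volume.withDensity fun x => ENNReal.ofReal (v x ^ 2)) (hh : 0 < h)
    (j : ℤ) :
    (slopeL h s Z j ^ 2 + slopeR h s Z j ^ 2) * h
      = ∫ x in grid h (2 * j)..grid h (2 * j + 2), v x ^ 2 := by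
  rw [sq_slopeL_add_sq_slopeR, projQ_sq D hac hh, ← two_mul_diffD_primitive D hac hh]
  ring

theorem setLIntegral_cell_eq (hh : 0 < h) (j : ℤ)
    {f : ℝ → ℝ} (hf0 : ∀ x, 0 ≤ f x) (hf : IntervalIntegrable f volume
      (grid h (2 * j)) (grid h (2 * j + 2))) :
    ∫⁻ x in cell h ⁻¹' {j}, ENNReal.ofReal (f x)
      = ENNReal.ofReal (∫ x in grid h (2 * j)..grid h (2 * j + 2), f x) := by
  have hle : grid h (2 * j) ≤ grid h (2 * j + 2) := by rw [grid_add_two]; linarith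
  rw [preimage_cell_singleton hh, intervalIntegral.integral_of_le hle,
    ofReal_integral_eq_lintegral_ofReal ((intervalIntegrable_iff_integrableOn_Ioc_of_le hle).1 hf)
      (Eventually.of_forall hf0)]

theorem setLIntegral_cell_projV (hh : 0 < h) (φ : ℝ → ℝ≥0∞) (j : ℤ) :
    ∫⁻ x in cell h ⁻¹' {j}, φ (projV h s Z x)
      = (φ (slopeL h s Z j) + φ (slopeR h s Z j)) * ENNReal.ofReal h := by
  rw [preimage_cell_singleton hh, grid_add_two,
    setLIntegral_projV_right hh s Z j φ (by linarith) le_rfl, add_mul]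
  congr 3; ring

/-- Energies agree cell by cell, hence on any union of cells. All cells give the total energy, the
cells left of a grid point give the primitive there. -/
theorem setLIntegral_projV_sq
    (D : EnergyDecomp Z.u v Z.μ (singPart Z.μ) N)
    (hac : acPart Z.μ = volume.withDensity fun x => ENNReal.ofReal (v x ^ 2)) (hh : 0 < h)
    (S : Set ℤ) :
    ∫⁻ x in cell h ⁻¹' S, ENNReal.ofReal (projV h s Z x ^ 2)
      = ∫⁻ x in cell h ⁻¹' S, ENNReal.ofReal (v x ^ 2) := by
  rw [setLIntegral_preimage_cell, setLIntegral_preimage_cell]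
  refine tsum_congr fun j => ?_
  rw [setLIntegral_cell_projV hh (fun t => ENNReal.ofReal (t ^ 2)),
    setLIntegral_cell_eq hh _ (fun _ => sq_nonneg _) (D.intervalIntegrable_sq _ _),
    ← sq_slopeL_add_sq_slopeR_eq (s := s) D hac hh,
    ← ENNReal.ofReal_add (sq_nonneg _) (sq_nonneg _), ← ENNReal.ofReal_mul (by positivity)]

theorem lintegral_projV_sq
    (D : EnergyDecomp Z.u v Z.μ (singPart Z.μ) N)
    (hac : acPart Z.μ = volume.withDensity fun x => ENNReal.ofReal (v x ^ 2)) (hh : 0 < h) :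
    ∫⁻ x, ENNReal.ofReal (projV h s Z x ^ 2) = ∫⁻ x, ENNReal.ofReal (v x ^ 2) := by
  simpa using setLIntegral_projV_sq (s := s) D hac hh univ

theorem memLp_projV
    (D : EnergyDecomp Z.u v Z.μ (singPart Z.μ) N)
    (hac : acPart Z.μ = volume.withDensity fun x => ENNReal.ofReal (v x ^ 2)) (hh : 0 < h) :
    MemLp (projV h s Z) 2 volume := by
  refine ⟨(measurable_projV h s Z).aestronglyMeasurable, ?_⟩
  have h1 := lintegral_projV_sq (s := s) D hac hh
  rw [lintegral_ofReal_sq_eq, lintegral_ofReal_sq_eq] at h1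
  exact ((ENNReal.pow_le_pow_left_iff two_ne_zero).1 h1.le).trans_lt D.memLp.2

/-! ### The projected energy has the prescribed primitive -/

theorem setLIntegral_Iic_grid
    (D : EnergyDecomp Z.u v Z.μ (singPart Z.μ) N)
    (hac : acPart Z.μ = volume.withDensity fun x => ENNReal.ofReal (v x ^ 2)) (hh : 0 < h)
    (j : ℤ) :
    ∫⁻ x in Iic (grid h (2 * j)), ENNReal.ofReal (projV h s Z x ^ 2)
      = ENNReal.ofReal (primitive (acPart Z.μ) (grid h (2 * j))) := by
  have hfin : IsFiniteMeasure (acPart Z.μ) := by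
    rw [hac]; exact isFiniteMeasure_withDensity_ofReal D.memLp.integrable_sq.2
  rw [← preimage_cell_Iio hh, setLIntegral_projV_sq D hac hh, preimage_cell_Iio hh,
    ofReal_primitive, hac, withDensity_apply _ measurableSet_Iio,
    Measure.restrict_congr_set Iio_ae_eq_Iic]

theorem primitive_withDensity_projV
    (D : EnergyDecomp Z.u v Z.μ (singPart Z.μ) N)
    (hac : acPart Z.μ = volume.withDensity fun x => ENNReal.ofReal (v x ^ 2)) (hh : 0 < h)
    (x : ℝ) :
    primitive (volume.withDensity fun x => ENNReal.ofReal (projV h s Z x ^ 2)) x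
      = projFac h s Z x := by
  set j := cell h x with hj
  have hx := cell_spec hh x
  rw [← hj] at hx
  have hF : 0 ≤ primitive (acPart Z.μ) (grid h (2 * j)) := primitive_nonneg _ _
  have hmid : primitive (acPart Z.μ) (grid h (2 * j + 2)) - primitive (acPart Z.μ) (grid h (2 * j))
      = 2 * h * (diffD h Z.u j ^ 2 + projQ h Z j ^ 2) := by
    rw [projQ_sq D hac hh, ← two_mul_diffD hh]; ring
  have hσ : (((s j : ℤ) : ℝ)) ^ 2 = 1 := by
    rcases Int.units_eq_one_or (s j) with h | h <;> simp [h]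
  rw [primitive, measureReal_def, withDensity_apply _ measurableSet_Iio,
    Measure.restrict_congr_set Iio_ae_eq_Iic, ← Iic_union_Ioc_eq_Iic hx.1.le,
    lintegral_union measurableSet_Ioc (Iic_disjoint_Ioc le_rfl), setLIntegral_Iic_grid D hac hh,
    projFac]
  simp only [← hj]
  split_ifs with hc
  · rw [grid_add_one] at hc
    rw [setLIntegral_projV_left hh s Z j (fun t => ENNReal.ofReal (t ^ 2)) hc,
      ← ENNReal.ofReal_mul (sq_nonneg _),
      ← ENNReal.ofReal_add hF (mul_nonneg (sq_nonneg _) (by linarith [hx.1])),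
      ENNReal.toReal_ofReal (add_nonneg hF (mul_nonneg (sq_nonneg _) (by linarith [hx.1])))]
    rfl
  · rw [grid_add_one, not_le] at hc
    have h1 : 0 ≤ slopeL h s Z j ^ 2 * h := by positivity
    have h2 : 0 ≤ slopeR h s Z j ^ 2 * (x - (grid h (2 * j) + h)) :=
      mul_nonneg (sq_nonneg _) (by linarith)
    rw [setLIntegral_projV_right hh s Z j (fun t => ENNReal.ofReal (t ^ 2)) hc.le
        (by rw [← grid_add_two]; exact hx.2),
      ← ENNReal.ofReal_mul (sq_nonneg _), ← ENNReal.ofReal_mul (sq_nonneg _),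
      ← ENNReal.ofReal_add h1 h2, ← ENNReal.ofReal_add hF (add_nonneg h1 h2),
      ENNReal.toReal_ofReal (add_nonneg hF (add_nonneg h1 h2)), grid_add_one]
    simp only [slopeL, slopeR]
    -- By `hmid`, the midpoint average of `F_ac` is `F_{ac,2j} + h (d² + q²)`, which together with
    -- `-2 σ d q h` is the left-half energy `h (d - σ q)²` added to `F_{ac,2j}`.
    linear_combination h * projQ h Z j ^ 2 * hσ - 1 / 2 * hmid

theorem primitive_projSing (hh : 0 < h) (x : ℝ) :
    primitive (projSing h Z) x = projFsing h Z x := by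
  rw [primitive, projSing, map_measureReal_apply (measurable_leftGrid h) measurableSet_Iio,
    projFsing, primitive]
  congr 1
  ext z
  exact leftGrid_lt_iff hh

theorem isFiniteMeasure_projMeasure
    (D : EnergyDecomp Z.u v Z.μ (singPart Z.μ) N)
    (hac : acPart Z.μ = volume.withDensity fun x => ENNReal.ofReal (v x ^ 2)) (hh : 0 < h) :
    IsFiniteMeasure (projMeasure h s Z) := by
  have := D.finite
  have : IsFiniteMeasure (projSing h Z) := by rw [projSing]; infer_instance
  have : IsFiniteMeasure (volume.withDensity fun x => ENNReal.ofReal (projV h s Z x ^ 2)) :=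
    isFiniteMeasure_withDensity_ofReal (memLp_projV D hac hh).integrable_sq.2
  rw [projMeasure]; infer_instance

/-- Recognising `projF` as the primitive of `projMeasure` makes it monotone, so the default value
`0` of `measureOfPrimitive` is not taken. -/
theorem measureOfPrimitive_projF
    (D : EnergyDecomp Z.u v Z.μ (singPart Z.μ) N)
    (hac : acPart Z.μ = volume.withDensity fun x => ENNReal.ofReal (v x ^ 2)) (hh : 0 < h) :
    measureOfPrimitive (projF h s Z) = projMeasure h s Z := by
  have h0 := isFiniteMeasure_projMeasure (s := s) D hac hh
  have := D.finite
  have : IsFiniteMeasure (projSing h Z) := by rw [projSing]; infer_instance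
  have : IsFiniteMeasure (volume.withDensity fun x => ENNReal.ofReal (projV h s Z x ^ 2)) :=
    isFiniteMeasure_withDensity_ofReal (memLp_projV D hac hh).integrable_sq.2
  rw [← measureOfPrimitive_primitive (projMeasure h s Z)]
  congr 1
  ext x
  rw [projF, ← primitive_withDensity_projV D hac hh, ← primitive_projSing hh]
  simp only [primitive, projMeasure]
  rw [measureReal_add_apply]

theorem projMeasure_real_univ
    (D : EnergyDecomp Z.u v Z.μ (singPart Z.μ) N)
    (hac : acPart Z.μ = volume.withDensity fun x => ENNReal.ofReal (v x ^ 2)) (hh : 0 < h) :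
    (projMeasure h s Z).real univ = Z.μ.real univ := by
  rw [measureReal_def, measureReal_def]
  conv_rhs => rw [D.eq]
  rw [projMeasure, Measure.add_apply, Measure.add_apply, withDensity_apply _ .univ,
    withDensity_apply _ .univ, Measure.restrict_univ, lintegral_projV_sq D hac hh, projSing,
    Measure.map_apply (measurable_leftGrid h) .univ, preimage_univ]

/-- Exact agreement at even grid points is what locks the two characteristics into the same cell. -/
theorem primitive_projMeasure_grid
    (D : EnergyDecomp Z.u v Z.μ (singPart Z.μ) N)
    (hac : acPart Z.μ = volume.withDensity fun x => ENNReal.ofReal (v x ^ 2)) (hh : 0 < h)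
    (j : ℤ) :
    primitive (projMeasure h s Z) (grid h (2 * j)) = primitive Z.μ (grid h (2 * j)) := by
  rw [primitive, primitive, measureReal_def, measureReal_def]
  conv_rhs => rw [D.eq]
  rw [projMeasure, Measure.add_apply, Measure.add_apply, withDensity_apply _ measurableSet_Iio,
    withDensity_apply _ measurableSet_Iio, Measure.restrict_congr_set Iio_ae_eq_Iic,
    ← preimage_cell_Iio hh, setLIntegral_projV_sq D hac hh, projSing,
    Measure.map_apply (measurable_leftGrid h) measurableSet_Iio]
  congr 3
  ext z
  exact leftGrid_lt_grid_iff hh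

end Projection

end HunterSaxton

namespace HunterSaxton

section Projection

variable {h : ℝ} {s : ℤ → ℤˣ} {Z : Eulerian} {v : ℝ → ℝ} {N : Set ℝ}

/-! ### The projected velocity -/

theorem intervalIntegrable_projV
    (D : EnergyDecomp Z.u v Z.μ (singPart Z.μ) N)
    (hac : acPart Z.μ = volume.withDensity fun x => ENNReal.ofReal (v x ^ 2)) (hh : 0 < h)
    (a b : ℝ) : IntervalIntegrable (projV h s Z) volume a b :=
  (((memLp_projV D hac hh).locallyIntegrable (by simp)).integrableOn_isCompact
    isCompact_uIcc).intervalIntegrable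

theorem integral_projV_left (hh : 0 < h) (j : ℤ) {x y : ℝ} (hx : grid h (2 * j) ≤ x) (hxy : x ≤ y)
    (hy : y ≤ grid h (2 * j) + h) :
    ∫ t in x..y, projV h s Z t = slopeL h s Z j * (y - x) := by
  rw [intervalIntegral.integral_of_le hxy,
    setIntegral_congr_fun (g := fun _ => slopeL h s Z j) measurableSet_Ioc fun t ht =>
      projV_of_mem_left hh s Z j ⟨hx.trans_lt ht.1, ht.2.trans hy⟩,
    ← intervalIntegral.integral_of_le hxy, intervalIntegral.integral_const, smul_eq_mul, mul_comm]

theorem integral_projV_right (hh : 0 < h) (j : ℤ) {x y : ℝ} (hx : grid h (2 * j) + h ≤ x)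
    (hxy : x ≤ y) (hy : y ≤ grid h (2 * j) + 2 * h) :
    ∫ t in x..y, projV h s Z t = slopeR h s Z j * (y - x) := by
  rw [intervalIntegral.integral_of_le hxy,
    setIntegral_congr_fun (g := fun _ => slopeR h s Z j) measurableSet_Ioc fun t ht =>
      projV_of_mem_right hh s Z j ⟨hx.trans_lt ht.1, ht.2.trans hy⟩,
    ← intervalIntegral.integral_of_le hxy, intervalIntegral.integral_const, smul_eq_mul, mul_comm]

theorem integral_projV_cell
    (D : EnergyDecomp Z.u v Z.μ (singPart Z.μ) N)
    (hac : acPart Z.μ = volume.withDensity fun x => ENNReal.ofReal (v x ^ 2)) (hh : 0 < h)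
    (j : ℤ) :
    ∫ t in grid h (2 * j)..grid h (2 * j + 2), projV h s Z t
      = Z.u (grid h (2 * j + 2)) - Z.u (grid h (2 * j)) := by
  have hi := intervalIntegrable_projV (s := s) D hac hh
  rw [← two_mul_diffD hh, grid_add_two,
    ← intervalIntegral.integral_add_adjacent_intervals (hi _ (grid h (2 * j) + h)) (hi _ _),
    integral_projV_left hh j le_rfl (by linarith) le_rfl,
    integral_projV_right hh j le_rfl (by linarith) le_rfl, slopeL, slopeR]
  ring

theorem integral_projV_grid
    (D : EnergyDecomp Z.u v Z.μ (singPart Z.μ) N)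
    (hac : acPart Z.μ = volume.withDensity fun x => ENNReal.ofReal (v x ^ 2)) (hh : 0 < h)
    (j : ℤ) :
    Z.u (grid h (2 * j)) = Z.u 0 + ∫ t in (0 : ℝ)..grid h (2 * j), projV h s Z t := by
  have hi := intervalIntegrable_projV (s := s) D hac hh
  have hstep : ∀ k : ℤ, (∫ t in (0 : ℝ)..grid h (2 * (k + 1)), projV h s Z t)
      = (∫ t in (0 : ℝ)..grid h (2 * k), projV h s Z t)
        + (Z.u (grid h (2 * (k + 1))) - Z.u (grid h (2 * k))) := fun k => by
    rw [show 2 * (k + 1) = 2 * k + 2 by ring, ← integral_projV_cell (s := s) D hac hh k,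
      intervalIntegral.integral_add_adjacent_intervals (hi _ _) (hi _ _)]
  induction j using Int.induction_on with
  | zero => simp [grid]
  | succ k ih => rw [hstep]; linarith
  | pred k ih =>
    have := hstep (-(k : ℤ) - 1)
    rw [sub_add_cancel] at this
    linarith

theorem projU_eq
    (D : EnergyDecomp Z.u v Z.μ (singPart Z.μ) N)
    (hac : acPart Z.μ = volume.withDensity fun x => ENNReal.ofReal (v x ^ 2)) (hh : 0 < h)
    (x : ℝ) : projU h s Z x = Z.u 0 + ∫ t in (0 : ℝ)..x, projV h s Z t := by
  have hi := intervalIntegrable_projV (s := s) D hac hh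
  set j := cell h x with hj
  have hx := cell_spec hh x
  rw [← hj] at hx
  simp only [projU, ← hj]
  split_ifs with hc
  · rw [grid_add_one] at hc
    rw [← intervalIntegral.integral_add_adjacent_intervals (hi 0 (grid h (2 * j))) (hi _ x),
      integral_projV_left hh j le_rfl hx.1.le hc, ← add_assoc,
      ← integral_projV_grid D hac hh, slopeL]
  · rw [grid_add_one, not_le] at hc
    have h1 := integral_projV_grid (s := s) D hac hh (j + 1)
    rw [show 2 * (j + 1) = 2 * j + 2 by ring] at h1
    have h2 := intervalIntegral.integral_add_adjacent_intervals (hi 0 x) (hi x (grid h (2 * j + 2)))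
    have h3 := hx.2
    rw [grid_add_two] at h3
    have h4 := integral_projV_right (s := s) (Z := Z) hh j hc.le h3 le_rfl
    rw [← grid_add_two] at h4
    rw [h1, ← h2, h4, slopeR]
    ring

theorem projU_grid
    (D : EnergyDecomp Z.u v Z.μ (singPart Z.μ) N)
    (hac : acPart Z.μ = volume.withDensity fun x => ENNReal.ofReal (v x ^ 2)) (hh : 0 < h)
    (j : ℤ) : projU h s Z (grid h (2 * j)) = Z.u (grid h (2 * j)) := by
  rw [projU_eq D hac hh, integral_projV_grid (s := s) D hac hh j]

/-- The projected singular part consists of atoms on the countable grid, so `N` can be the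
complement of the grid. -/
theorem energyDecomp_proj
    (D : EnergyDecomp Z.u v Z.μ (singPart Z.μ) N)
    (hac : acPart Z.μ = volume.withDensity fun x => ENNReal.ofReal (v x ^ 2)) (hh : 0 < h) :
    EnergyDecomp (projU h s Z) (projV h s Z) (projMeasure h s Z) (projSing h Z)
      (range (grid h))ᶜ where
  measurable := measurable_projV h s Z
  memLp := memLp_projV D hac hh
  finite := by
    have := D.finite
    rw [projSing]; infer_instance
  measurableSet := (countable_range _).measurableSet.compl
  sing_null := by
    rw [projSing, Measure.map_apply (measurable_leftGrid h)
      (countable_range _).measurableSet.compl]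
    have h0 : leftGrid h ⁻¹' (range (grid h))ᶜ = ∅ := by
      ext z
      simp [leftGrid]
    rw [h0, measure_empty]
  compl_null := by
    rw [compl_compl]
    exact (countable_range _).measure_zero _
  eq := rfl
  ftc a b := by
    have hi := intervalIntegrable_projV (s := s) D hac hh
    rw [projU_eq D hac hh, projU_eq D hac hh, ← intervalIntegral.integral_add_adjacent_intervals
      (hi 0 a) (hi a b)]
    ring

/-! ### Convergence of the projections -/

/-- Whether a characteristic lies left of `x_{2j}` depends only on `F(x_{2j})`, which the projection
preserves. -/
theorem exists_cell_charY
    (D : EnergyDecomp Z.u v Z.μ (singPart Z.μ) N)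
    (hac : acPart Z.μ = volume.withDensity fun x => ENNReal.ofReal (v x ^ 2)) (hh : 0 < h)
    (ξ : ℝ) : ∃ j : ℤ, charY Z.μ ξ ∈ Ico (grid h (2 * j)) (grid h (2 * j) + 2 * h) ∧
      charY (projMeasure h s Z) ξ ∈ Ico (grid h (2 * j)) (grid h (2 * j) + 2 * h) := by
  have := D.isFiniteMeasure
  have := isFiniteMeasure_projMeasure (s := s) D hac hh
  have hiff : ∀ j : ℤ, charY (projMeasure h s Z) ξ < grid h (2 * j)
      ↔ charY Z.μ ξ < grid h (2 * j) := fun j => by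
    rw [charY_lt_iff, charY_lt_iff, primitive_projMeasure_grid D hac hh]
  set j := ⌊charY Z.μ ξ / (2 * h)⌋ with hj
  have h1 : grid h (2 * j) ≤ charY Z.μ ξ := leftGrid_le hh _
  have h2 : charY Z.μ ξ < grid h (2 * j) + 2 * h := lt_leftGrid_add hh _
  refine ⟨j, ⟨h1, h2⟩, ?_, ?_⟩
  · exact not_lt.1 fun h3 => absurd ((hiff j).1 h3) (not_lt.2 h1)
  · have h4 := hiff (j + 1)
    rw [show 2 * (j + 1) = 2 * j + 2 by ring, grid_add_two] at h4
    exact h4.2 h2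

theorem abs_charY_sub_le
    (D : EnergyDecomp Z.u v Z.μ (singPart Z.μ) N)
    (hac : acPart Z.μ = volume.withDensity fun x => ENNReal.ofReal (v x ^ 2)) (hh : 0 < h)
    (ξ : ℝ) : |charY Z.μ ξ - charY (projMeasure h s Z) ξ| ≤ 2 * h := by
  obtain ⟨j, h1, h2⟩ := exists_cell_charY (s := s) D hac hh ξ
  rw [abs_le]
  constructor <;> linarith [h1.1, h1.2, h2.1, h2.2]

/-- Both velocities are compared with their common value at the left end of the shared cell, each at
the cost of one Hölder-1/2 bound. -/
theorem abs_u_charY_sub_le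
    (D : EnergyDecomp Z.u v Z.μ (singPart Z.μ) N)
    (hac : acPart Z.μ = volume.withDensity fun x => ENNReal.ofReal (v x ^ 2)) (hh : 0 < h)
    (ξ : ℝ) : |Z.u (charY Z.μ ξ) - projU h s Z (charY (projMeasure h s Z) ξ)|
      ≤ 2 * √(2 * h * ∫ x, v x ^ 2) := by
  have D' := energyDecomp_proj (s := s) D hac hh
  obtain ⟨j, h1, h2⟩ := exists_cell_charY (s := s) D hac hh ξ
  have hI : 0 ≤ ∫ x, v x ^ 2 := integral_nonneg fun x => sq_nonneg _
  have hE : ∫ x, projV h s Z x ^ 2 = ∫ x, v x ^ 2 := by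
    rw [integral_eq_lintegral_of_nonneg_ae (Eventually.of_forall fun x => sq_nonneg _)
      ((measurable_projV h s Z).pow_const 2).aestronglyMeasurable,
      integral_eq_lintegral_of_nonneg_ae (Eventually.of_forall fun x => sq_nonneg _)
      (D.measurable.pow_const 2).aestronglyMeasurable, lintegral_projV_sq D hac hh]
  have h3 := D.abs_sub_le h1.1
  have h4 := D'.abs_sub_le h2.1
  rw [hE, projU_grid D hac hh] at h4
  have h5 : ∀ {y : ℝ}, y < grid h (2 * j) + 2 * h →
      √((y - grid h (2 * j)) * ∫ x, v x ^ 2) ≤ √(2 * h * ∫ x, v x ^ 2) := fun hy =>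
    Real.sqrt_le_sqrt (mul_le_mul_of_nonneg_right (by linarith) hI)
  have h6 := h3.trans (h5 h1.2)
  have h7 := h4.trans (h5 h2.2)
  rw [abs_sub_comm] at h7
  calc _ = |(Z.u (charY Z.μ ξ) - Z.u (grid h (2 * j)))
      + (Z.u (grid h (2 * j)) - projU h s Z (charY (projMeasure h s Z) ξ))| := by ring_nf
    _ ≤ _ := (abs_add_le _ _).trans (by linarith)

/-- On the cell `v` and `projV` have the same mean `d` and the same energy, hence equal `L²`
deviation from `d`. This gives `‖v - projV‖² ≤ 4 ‖v - d‖²`, and `d` is the best constant. -/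
theorem setLIntegral_sub_projV_sq_le
    (D : EnergyDecomp Z.u v Z.μ (singPart Z.μ) N)
    (hac : acPart Z.μ = volume.withDensity fun x => ENNReal.ofReal (v x ^ 2)) (hh : 0 < h)
    (j : ℤ) (c : ℝ) :
    ∫⁻ x in cell h ⁻¹' {j}, ENNReal.ofReal ((v x - projV h s Z x) ^ 2)
      ≤ 4 * ∫⁻ x in cell h ⁻¹' {j}, ENNReal.ofReal ((v x - c) ^ 2) := by
  have D' := energyDecomp_proj (s := s) D hac hh
  have hle : grid h (2 * j) ≤ grid h (2 * j + 2) := by rw [grid_add_two]; linarith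
  have hlen : grid h (2 * j + 2) - grid h (2 * j) = 2 * h := by rw [grid_add_two]; ring
  have hci : ∀ c : ℝ, IntervalIntegrable (fun x => (v x - c) ^ 2) volume
      (grid h (2 * j)) (grid h (2 * j + 2)) := fun c => by
    have : ∀ x, (v x - c) ^ 2 = v x ^ 2 - 2 * c * v x + c ^ 2 := fun x => by ring
    simp_rw [this]
    exact ((D.intervalIntegrable_sq _ _).sub ((D.intervalIntegrable _ _).const_mul _)).add
      (by simp)
  have hci' : ∀ c : ℝ, IntervalIntegrable (fun x => (projV h s Z x - c) ^ 2) volume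
      (grid h (2 * j)) (grid h (2 * j + 2)) := fun c => by
    have : ∀ x, (projV h s Z x - c) ^ 2
        = projV h s Z x ^ 2 - 2 * c * projV h s Z x + c ^ 2 := fun x => by ring
    simp_rw [this]
    exact ((D'.intervalIntegrable_sq _ _).sub ((D'.intervalIntegrable _ _).const_mul _)).add
      (by simp)
  have hdi : IntervalIntegrable (fun x => (v x - projV h s Z x) ^ 2) volume
      (grid h (2 * j)) (grid h (2 * j + 2)) :=
    (memLp_fun_sub D.memLp D'.memLp).integrable_sq.intervalIntegrable
  rw [setLIntegral_cell_eq hh _ (fun _ => sq_nonneg _) hdi,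
    setLIntegral_cell_eq hh _ (fun _ => sq_nonneg _) (hci c),
    show (4 : ℝ≥0∞) = ENNReal.ofReal 4 by simp, ← ENNReal.ofReal_mul (by norm_num)]
  refine ENNReal.ofReal_le_ofReal ?_
  set d := diffD h Z.u j
  have hE : ∫ x in grid h (2 * j)..grid h (2 * j + 2), projV h s Z x ^ 2
      = ∫ x in grid h (2 * j)..grid h (2 * j + 2), v x ^ 2 := by
    have h1 := setLIntegral_projV_sq (s := s) D hac hh {j}
    rw [setLIntegral_cell_eq hh _ (fun _ => sq_nonneg _) (D.intervalIntegrable_sq _ _),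
      setLIntegral_cell_eq hh _ (fun _ => sq_nonneg _) (D'.intervalIntegrable_sq _ _)] at h1
    exact (ENNReal.ofReal_eq_ofReal_iff
      (intervalIntegral.integral_nonneg hle fun _ _ => sq_nonneg _)
      (intervalIntegral.integral_nonneg hle fun _ _ => sq_nonneg _)).1 h1
  have hu : Z.u (grid h (2 * j + 2)) - Z.u (grid h (2 * j)) = 2 * h * d :=
    (two_mul_diffD hh _ _).symm
  have hu' : projU h s Z (grid h (2 * j + 2)) - projU h s Z (grid h (2 * j)) = 2 * h * d := by
    rw [← hu, show 2 * j + 2 = 2 * (j + 1) by ring, projU_grid D hac hh, projU_grid D hac hh]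
  have e1 := D.integral_sub_const_sq (grid h (2 * j)) (grid h (2 * j + 2)) d
  have e2 := D'.integral_sub_const_sq (grid h (2 * j)) (grid h (2 * j + 2)) d
  have e3 := D.integral_sub_const_sq (grid h (2 * j)) (grid h (2 * j + 2)) c
  rw [hlen, hu] at e1 e3
  rw [hlen, hu', hE] at e2
  have e4 : ∫ x in grid h (2 * j)..grid h (2 * j + 2), (v x - projV h s Z x) ^ 2
      ≤ 2 * (∫ x in grid h (2 * j)..grid h (2 * j + 2), (v x - d) ^ 2)
        + 2 * ∫ x in grid h (2 * j)..grid h (2 * j + 2), (projV h s Z x - d) ^ 2 := by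
    rw [← intervalIntegral.integral_const_mul, ← intervalIntegral.integral_const_mul,
      ← intervalIntegral.integral_add ((hci d).const_mul _) ((hci' d).const_mul _)]
    refine intervalIntegral.integral_mono_on hle hdi
      (((hci d).const_mul _).add ((hci' d).const_mul _)) fun x _ => ?_
    nlinarith [sq_nonneg ((v x - d) + (projV h s Z x - d))]
  rw [e3]
  nlinarith [mul_nonneg hh.le (sq_nonneg (c - d))]

/-- The projected velocity gradient is a quasi-optimal piecewise constant approximation. -/
theorem eLpNorm_sub_projV_le
    (D : EnergyDecomp Z.u v Z.μ (singPart Z.μ) N)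
    (hac : acPart Z.μ = volume.withDensity fun x => ENNReal.ofReal (v x ^ 2)) (hh : 0 < h)
    (c : ℤ → ℝ) :
    eLpNorm (fun x => v x - projV h s Z x) 2 volume
      ≤ 2 * eLpNorm (fun x => v x - c (cell h x)) 2 volume := by
  have h1 : ∫⁻ x in cell h ⁻¹' univ, ENNReal.ofReal ((v x - projV h s Z x) ^ 2)
      ≤ 4 * ∫⁻ x in cell h ⁻¹' univ, ENNReal.ofReal ((v x - c (cell h x)) ^ 2) := by
    rw [setLIntegral_preimage_cell, setLIntegral_preimage_cell, ← ENNReal.tsum_mul_left]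
    refine ENNReal.tsum_le_tsum fun j => ?_
    refine (setLIntegral_sub_projV_sq_le D hac hh j (c j)).trans_eq ?_
    congr 1
    refine setLIntegral_congr_fun (measurable_cell h (measurableSet_singleton _)) fun x hx => ?_
    have : cell h x = j := hx
    simp only [this]
  rw [preimage_univ, Measure.restrict_univ, lintegral_ofReal_sq_eq, lintegral_ofReal_sq_eq,
    show (4 : ℝ≥0∞) = 2 ^ 2 by norm_num, ← mul_pow] at h1
  exact (ENNReal.pow_le_pow_left_iff two_ne_zero).1 h1

theorem tendsto_eLpNorm_sub_comp_cell {ψ : ℝ → ℝ} {K : NNReal} (hK : LipschitzWith K ψ)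
    (hψ : HasCompactSupport ψ) :
    Tendsto (fun h : ℝ => eLpNorm (fun x => ψ x - ψ (grid h (2 * cell h x))) 2 volume)
      (𝓝[>] 0) (𝓝 0) := by
  obtain ⟨R, hR⟩ := hψ.isCompact.isBounded.subset_closedBall 0
  have hz : ∀ x, R < |x| → ψ x = 0 := fun x hx => by
    by_contra hne
    have := hR (subset_tsupport ψ hne)
    rw [mem_closedBall_zero_iff, Real.norm_eq_abs] at this
    linarith
  set S : Set ℝ := Metric.closedBall 0 (R + 1)
  have hS : eLpNorm (S.indicator fun _ => (1 : ℝ)) 2 volume ≠ ∞ :=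
    (memLp_indicator_const 2 measurableSet_closedBall 1 (Or.inr
      measure_closedBall_lt_top.ne)).2.ne
  have hlim : Tendsto (fun h : ℝ => ENNReal.ofReal (K * (2 * h))
      * eLpNorm (S.indicator fun _ => (1 : ℝ)) 2 volume) (𝓝[>] 0) (𝓝 0) := by
    have h1 : Tendsto (fun h : ℝ => ENNReal.ofReal (K * (2 * h))) (𝓝[>] 0) (𝓝 0) := by
      have h2 : Continuous fun h : ℝ => ENNReal.ofReal (K * (2 * h)) :=
        ENNReal.continuous_ofReal.comp (by fun_prop)
      simpa using (h2.tendsto 0).mono_left nhdsWithin_le_nhds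
    simpa using ENNReal.Tendsto.mul_const h1 (Or.inr hS)
  refine tendsto_of_tendsto_of_tendsto_of_le_of_le' tendsto_const_nhds hlim
    (Eventually.of_forall fun _ => zero_le) ?_
  -- For `h < 1/2` the grid point is within distance 1 of `x`, so the error vanishes outside the
  -- ball of radius `R + 1`.
  filter_upwards [Ioo_mem_nhdsGT (show (0 : ℝ) < 1 / 2 by norm_num)] with h hh
  have hh0 : 0 < h := hh.1
  have e : ENNReal.ofReal (K * (2 * h)) = ‖(K : ℝ) * (2 * h)‖ₑ :=
    (Real.enorm_eq_ofReal (by positivity)).symm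
  rw [e, ← eLpNorm_const_smul]
  refine eLpNorm_mono fun x => ?_
  obtain ⟨h1, h2⟩ := cell_spec hh0 x
  rw [grid_add_two] at h2
  have h3 : |x - grid h (2 * cell h x)| ≤ 2 * h := by
    rw [abs_of_pos (by linarith)]; linarith
  by_cases hx : x ∈ S
  · have h4 := hK.dist_le_mul x (grid h (2 * cell h x))
    rw [Real.dist_eq, Real.dist_eq] at h4
    rw [Pi.smul_apply, indicator_of_mem hx, smul_eq_mul, mul_one,
      Real.norm_of_nonneg (by positivity : (0 : ℝ) ≤ K * (2 * h))]
    exact h4.trans (mul_le_mul_of_nonneg_left h3 K.coe_nonneg)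
  · have h5 : R + 1 < |x| := by
      rw [mem_closedBall_zero_iff, Real.norm_eq_abs, not_le] at hx; exact hx
    have h6 : R < |grid h (2 * cell h x)| := by
      have := abs_sub_abs_le_abs_sub x (grid h (2 * cell h x))
      linarith [hh.2]
    rw [hz x (by linarith), hz _ h6, sub_zero, norm_zero]
    exact norm_nonneg _

theorem tendsto_eLpNorm_sub_projV
    (D : EnergyDecomp Z.u v Z.μ (singPart Z.μ) N)
    (hac : acPart Z.μ = volume.withDensity fun x => ENNReal.ofReal (v x ^ 2))
    (σ : ℝ → ℤ → ℤˣ) :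
    Tendsto (fun h : ℝ => eLpNorm (fun x => v x - projV h (σ h) Z x) 2 volume)
      (𝓝[>] 0) (𝓝 0) := by
  rw [ENNReal.tendsto_nhds_zero]
  intro ε hε
  obtain ⟨δ, hδ, hδε⟩ := ENNReal.lt_iff_exists_nnreal_btwn.1 hε
  -- Two errors of `δ / 4`, smoothing and sampling, are doubled by `eLpNorm_sub_projV_le`.
  have hδ' : (0 : ℝ) < δ / 4 := by
    have : (0 : ℝ) < δ := by exact_mod_cast hδ
    positivity
  obtain ⟨ψ, hψc, hψs, hψ⟩ := D.memLp.exist_eLpNorm_sub_le (by simp) (by simp) hδ'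
  obtain ⟨K, hK⟩ : ∃ K, LipschitzWith K ψ :=
    hψs.lipschitzWith_of_hasCompactSupport hψc (by simp)
  filter_upwards [self_mem_nhdsWithin, ENNReal.tendsto_nhds_zero.1
    (tendsto_eLpNorm_sub_comp_cell hK hψc) (ENNReal.ofReal (δ / 4)) (by simpa using hδ')]
    with h hh h1
  have hh0 : 0 < h := hh
  have hm : Measurable fun x => ψ (grid h (2 * cell h x)) :=
    (measurable_from_top (f := fun j : ℤ => ψ (grid h (2 * j)))).comp (measurable_cell h)
  refine (eLpNorm_sub_projV_le D hac hh0 fun j => ψ (grid h (2 * j))).trans (le_trans ?_ hδε.le)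
  have h2 : eLpNorm (fun x => v x - ψ (grid h (2 * cell h x))) 2 volume
      ≤ ENNReal.ofReal (δ / 4) + ENNReal.ofReal (δ / 4) := by
    have e : (fun x => v x - ψ (grid h (2 * cell h x)))
        = (v - ψ) + fun x => ψ x - ψ (grid h (2 * cell h x)) := by ext x; simp
    rw [e]
    refine (eLpNorm_add_le (D.measurable.sub hψs.continuous.measurable).aestronglyMeasurable
      (hψs.continuous.measurable.sub hm).aestronglyMeasurable (by simp)).trans (add_le_add hψ h1)
  refine (mul_le_mul_right h2 2).trans_eq ?_
  rw [← ENNReal.ofReal_add hδ'.le hδ'.le, ← ENNReal.ofReal_ofNat 2,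
    ← ENNReal.ofReal_mul zero_le_two, ← ENNReal.ofReal_coe_nnreal]
  congr 1; ring

end Projection

end HunterSaxton

namespace HunterSaxton

/-! ## Eulerian coordinates in `𝒟₀^α` -/

theorem contDiff_chiPlus : ContDiff ℝ 1 chiPlus :=
  Real.smoothTransition.contDiff.comp (contDiff_id.add contDiff_const)

theorem MemE2.integral_deriv {f : ℝ → ℝ} (hf : MemE2 f) (a b : ℝ) :
    f b - f a = ∫ x in a..b, deriv f x := by
  obtain ⟨g, c, d, hg, hfg⟩ := hf
  have h1 : AbsolutelyContinuousOnInterval (fun x => c * chiPlus x + d * chiMinus x) a b := by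
    refine ContDiffOn.absolutelyContinuousOnInterval (ContDiff.contDiffOn ?_)
    exact (contDiff_const.mul contDiff_chiPlus).add
      (contDiff_const.mul (contDiff_const.sub contDiff_chiPlus))
  have h2 : f = g + fun x => c * chiPlus x + d * chiMinus x := by
    ext x; rw [hfg, Pi.add_apply, add_assoc]
  rw [h2]
  exact ((hg.2.1 a b).add h1).integral_deriv_eq_sub.symm

theorem MemH1.exists_bound {g : ℝ → ℝ} (hg : MemH1 g) : ∃ C, ∀ x, |g x| ≤ C := by
  obtain ⟨hg2, hac, hg'⟩ := hg
  -- A zero singular part lets the Hölder-1/2 bound apply to `g`; averaging over `[x, x + 1]` with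
  -- `|g| ≤ g² + 1` then bounds `|g x|`.
  have D : EnergyDecomp g (deriv g)
      (volume.withDensity (fun x => ENNReal.ofReal (deriv g x ^ 2)) + 0) 0 univ :=
    { measurable := measurable_deriv g
      memLp := hg'
      finite := inferInstance
      measurableSet := .univ
      sing_null := rfl
      compl_null := by simp
      eq := rfl
      ftc := fun a b => (hac a b).integral_deriv_eq_sub.symm }
  refine ⟨1 + (∫ y, g y ^ 2) + √(∫ y, deriv g y ^ 2), fun x => ?_⟩
  have hi : IntervalIntegrable (fun y => g y ^ 2) volume x (x + 1) :=
    hg2.integrable_sq.intervalIntegrable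
  have h1 : ∫ _ in x..x + 1, |g x|
      ≤ ∫ y in x..x + 1, (g y ^ 2 + (1 + √(∫ y, deriv g y ^ 2))) := by
    refine intervalIntegral.integral_mono_on (by linarith) (by simp) (hi.add (by simp))
      fun y hy => ?_
    have h2 := D.abs_sub_le hy.1
    have h3 : √((y - x) * ∫ y, deriv g y ^ 2) ≤ √(∫ y, deriv g y ^ 2) := by
      refine Real.sqrt_le_sqrt (mul_le_of_le_one_left (integral_nonneg fun _ => sq_nonneg _) ?_)
      linarith [hy.2]
    have h4 := abs_sub_abs_le_abs_sub (g x) (g y)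
    rw [abs_sub_comm] at h4
    have h5 : |g y| ≤ g y ^ 2 + 1 := by
      rw [← sq_abs (g y)]; nlinarith [sq_nonneg (|g y| - 1)]
    linarith
  rw [intervalIntegral.integral_add hi (by simp)] at h1
  simp only [intervalIntegral.integral_const, add_sub_cancel_left, smul_eq_mul, one_mul] at h1
  have h6 : ∫ y in x..x + 1, g y ^ 2 ≤ ∫ y, g y ^ 2 := by
    rw [intervalIntegral.integral_of_le (by linarith)]
    exact setIntegral_le_integral hg2.integrable_sq (Eventually.of_forall fun _ => sq_nonneg _)
  linarith

theorem MemE2.exists_bound {f : ℝ → ℝ} (hf : MemE2 f) : ∃ C, ∀ x, |f x| ≤ C := by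
  obtain ⟨g, a, b, hg, hfg⟩ := hf
  obtain ⟨C, hC⟩ := hg.exists_bound
  refine ⟨C + |a| + |b|, fun x => ?_⟩
  have h0 : 0 ≤ chiPlus x := Real.smoothTransition.nonneg _
  have h1 : chiPlus x ≤ 1 := Real.smoothTransition.le_one _
  have h2 : |a * chiPlus x| ≤ |a| := by
    rw [abs_mul, abs_of_nonneg h0]
    exact mul_le_of_le_one_right (abs_nonneg _) h1
  have h3 : |b * chiMinus x| ≤ |b| := by
    rw [abs_mul, chiMinus, abs_of_nonneg (sub_nonneg.2 h1)]
    exact mul_le_of_le_one_right (abs_nonneg _) (by linarith)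
  rw [hfg]
  linarith [abs_add_three (g x) (a * chiPlus x) (b * chiMinus x), hC x]

/-- Square integrability of `u_x` comes from finiteness of `μ`, whose absolutely continuous part is
`u_x² dx`. -/
theorem MemD.exists_energyDecomp {Z : Eulerian} (hZ : MemD Z) :
    ∃ N, EnergyDecomp Z.u (deriv Z.u) Z.μ (singPart Z.μ) N := by
  have := hZ.finite_μ
  obtain ⟨N, hN, hs, hv⟩ := Measure.mutuallySingular_singularPart Z.μ volume
  refine ⟨N, measurable_deriv _, ?_, ?_, hN, hs, hv, ?_, hZ.u_mem.integral_deriv⟩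
  · refine ⟨(measurable_deriv _).aestronglyMeasurable, ?_⟩
    have h1 : ∫⁻ x, ENNReal.ofReal (deriv Z.u x ^ 2) < ∞ := by
      rw [← setLIntegral_univ, ← withDensity_apply _ .univ, ← hZ.ac_eq]
      exact (Measure.withDensity_rnDeriv_le Z.μ volume univ).trans_lt (measure_lt_top _ _)
    rw [lintegral_ofReal_sq_eq] at h1
    exact lt_top_iff_ne_top.2 fun h => by simp [h] at h1
  · rw [singPart]; infer_instance
  · rw [← hZ.ac_eq, add_comm]
    exact Measure.haveLebesgueDecomposition_add Z.μ volume

end HunterSaxton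

/-! ### Convergence of the projected Lagrangian coordinates -/

theorem corollary4p4 (α : ℝ → ℝ) (hα : HunterSaxton.MemW1Infty α)
    (Z : HunterSaxton.Eulerian) (hZ : Z ∈ HunterSaxton.D0)
    (s : ℝ → ℤ → ℤˣ) :
    Tendsto
      (fun Δx : ℝ => HunterSaxton.lagrDist α (HunterSaxton.L Z)
        (HunterSaxton.L (HunterSaxton.P Δx (s Δx) Z)))
      (𝓝[>] 0) (𝓝 0) := by
  obtain ⟨hD, hμν⟩ := hZ
  obtain ⟨N, D⟩ := hD.exists_energyDecomp
  obtain ⟨C, hC⟩ := hD.u_mem.exists_bound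
  have hac := hD.ac_eq
  -- The stability theorem needs an energy decomposition for every index, not just eventually, so
  -- the limit is taken over the subtype of positive `Δx`.
  have hIoi : (𝓝[>] (0 : ℝ)) = map ((↑) : Ioi (0 : ℝ) → ℝ) (comap (↑) (𝓝[>] (0 : ℝ))) := by
    rw [Filter.map_comap_of_mem]
    rw [Subtype.range_coe]
    exact self_mem_nhdsWithin
  have hcoe : Tendsto ((↑) : Ioi (0 : ℝ) → ℝ) (comap (↑) (𝓝[>] (0 : ℝ))) (𝓝[>] 0) := tendsto_comap
  have hZ' : Z = ⟨Z.u, Z.μ, Z.μ⟩ := by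
    conv_rhs => enter [3]; rw [hμν]
  have hP : ∀ h : Ioi (0 : ℝ), HunterSaxton.P h (s h) Z
      = ⟨HunterSaxton.projU h (s h) Z, HunterSaxton.projMeasure h (s h) Z,
        HunterSaxton.projMeasure h (s h) Z⟩ := fun h => by
    rw [HunterSaxton.P, HunterSaxton.measureOfPrimitive_projF D hac h.2]
  rw [hIoi, tendsto_map'_iff]
  have key := HunterSaxton.tendsto_lagrDist (l := comap ((↑) : Ioi (0 : ℝ) → ℝ) (𝓝[>] (0 : ℝ)))
    hα D (fun h : Ioi (0 : ℝ) => HunterSaxton.energyDecomp_proj (s := s h) D hac h.2)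
    (fun h => HunterSaxton.projMeasure_real_univ D hac h.2) hC (fun ε hε => ?_) (fun ε hε => ?_)
    ((HunterSaxton.tendsto_eLpNorm_sub_projV D hac s).comp hcoe)
  · rw [← hZ'] at key
    refine key.congr fun h => ?_
    rw [Function.comp_apply, hP]
  · have h1 : Tendsto (fun h : ℝ => 2 * h) (𝓝[>] 0) (𝓝 0) := by
      have h2 : Continuous fun h : ℝ => 2 * h := by fun_prop
      simpa using (h2.tendsto 0).mono_left nhdsWithin_le_nhds
    filter_upwards [(h1.comp hcoe).eventually (gt_mem_nhds hε)] with h hh ξ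
    exact (HunterSaxton.abs_charY_sub_le D hac h.2 ξ).trans hh.le
  · have h1 : Tendsto (fun h : ℝ => 2 * √(2 * h * ∫ x, deriv Z.u x ^ 2)) (𝓝[>] 0) (𝓝 0) := by
      have h2 : Continuous fun h : ℝ => 2 * √(2 * h * ∫ x, deriv Z.u x ^ 2) := by fun_prop
      simpa using (h2.tendsto 0).mono_left nhdsWithin_le_nhds
    filter_upwards [(h1.comp hcoe).eventually (gt_mem_nhds hε)] with h hh ξ
    exact (HunterSaxton.abs_u_charY_sub_le D hac h.2 ξ).trans hh.le
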